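/- **Theorem (Preliminary bounds).** All intervals are bounded and have positive length; for intervals $J, I$ write $J\Subset I$ if the closure of $J$ is contained in the interior of $I$. Let $I\subset[-1,1]$ be an interval and let $B, A$ be real numbers. Let $n$ be sufficiently large depending on $I, A, B$, let $x_1,\dots,x_n$ be distinct points of $[-1,1]$, and put $$P(z)=\prod_{i=1}^n (z-x_i),\qquad \ell_k(z)=\prod_{i\ne k}\frac{z-x_i}{x_k-x_i},\qquad \lambda(x)=\sum_{k=1}^n|\ell_k(x)|,\qquad \delta(x)=\min_{1\le i\le n}|x-x_i|,$$ $$\mu=\frac1n\sum_{i=1}^n\delta_{x_i},\qquad U_\mu(z)=\int_{\mathbb R}\log\frac1{|z-t|}\,d\mu(t)=\frac1n\log\frac1{|P(z)|},$$ where $\delta_{x_i}$ denotes the Dirac mass at $x_i$. Assume that $$\sup_{x\in I}\lambda(x)\le B\,n^{A}.$$ Implied constants below depend only on $I, A, B$ and, where a subscript $I'$ is written, also on $I'$. Then there are a real number $\alpha$ and a function $\rho$, continuous on the interior of $I$, such that the following hold. (i) $\alpha=O(1)$, and for all $x\in I$ $$\delta(x)e^{-n\alpha}\le|P(x)|\ll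 n^{O(1)}e^{-n\alpha},$$ or equivalently, for all $x\in I$ that are not nodes, $$\alpha-O\Big(\frac{\log n}{n}\Big)\le U_\mu(x)\le\alpha+\frac1n\log\frac1{\delta(x)}.$$ (ii) For every interval $I'\Subset I$ and all $x,x_0\in I'$, $$\rho(x_0)\asymp_{I'}1,\qquad \rho(x)=\rho(x_0)+O_{I'}(|x-x_0|),$$ and, for both choices of sign, whenever $x\in I'$ and $\eta\ge\frac{\log n}{n}$, $$U_\mu(x\pm i\eta)=\alpha-\pi\eta\rho(x)+O_{I'}\Big(\frac{\log n}{n}+\eta^3\Big).$$ (iii) For every interval $I'\Subset I$, all $x\in I'$ and all $\eta>0$, $$\mu([x-\eta,x+\eta])\ll_{I'}\eta+\frac{\log n}{n}.$$ (iv) For every interval $I'\Subset I$, every subinterval $J$ of $I'$ and every real $K\ge1$, $$\mu(J)=\int_J\rho(x)\,dx+O_{I'}\Big(\frac{|J|}{K}+\frac{K^2\log n}{n}\Big).$$ -/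

import Mathlib

open MeasureTheory

noncomputable section

/-- Intervals of the real line: bounded, of positive length (with or without endpoints). -/
def IsFiniteInterval (I : Set ℝ) : Prop :=
  I.OrdConnected ∧ I.Nontrivial ∧ Bornology.IsBounded I

/-- The relation `J ⋐ I`: the closure of `J` lies in the interior of `I`. -/
def CompactlyInside (J I : Set ℝ) : Prop :=
  closure J ⊆ interior I

/-- The monic polynomial `P(t) = ∏ i, (t - x i)` whose roots are the nodes. -/
def nodePolynomial {n : ℕ} (x : Fin n → ℝ) : Polynomial ℝ :=
  Lagrange.nodal Finset.univ x

/-- The Lebesgue function `λ(t) = ∑ k, |ℓ_k(t)|`, where `ℓ_k` is the Lagrange basis polynomial. -/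
def lebesgueFunction {n : ℕ} (x : Fin n → ℝ) (t : ℝ) : ℝ :=
  ∑ k, |(Lagrange.basis Finset.univ x k).eval t|

/-- The empirical measure `μ = (1/n) ∑ i, δ_{x i}`. -/
def empiricalMeasure {n : ℕ} (x : Fin n → ℝ) : Measure ℝ :=
  (n : ENNReal)⁻¹ • ∑ i, Measure.dirac (x i)

/-- The logarithmic potential `U_μ(z) = ∫ log (1 / |z - t|) dμ(t)`. -/
def logPotential (μ : Measure ℝ) (z : ℂ) : ℝ :=
  ∫ t, Real.log (1 / ‖z - (t : ℂ)‖) ∂μ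

/-- The distance `δ(t) = min_i |t - x i|` to the nearest node. -/
def nodeDistance {n : ℕ} (x : Fin n → ℝ) (t : ℝ) : ℝ :=
  ⨅ i, |t - x i|

end

/-! Write `ℓ_k(t) = P(t) w_k / (t - x_k)` with `w_k` the nodal weights. Since `∑ ℓ_k = 1`, one has
`1 ≤ |P| n max|w| / δ` on the whole line; since the single term of largest weight is at most `λ`,
also `|P| ≪ λ / max|w|` on `I`. Putting `e^{nα} = n max|w|` gives (i)
(`exists_equilibrium_constant`): apart from logarithmic peaks at the nodes, `U - α` is `O(log n /
n)` on `I`, and the upper bound holds on all of `ℝ`.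

The value `U(y + iη)` is the Poisson integral of the boundary values of `U`
(`integral_halfPlanePoisson_mul_nodePotential`). Split that integral at `I`. For `η ≥ log n / n` the
kernel is at most `n`, so it averages the peaks away and `I` contributes `O(log n / n)`. Off `I` the
point `y` is at distance at least `d`, and the kernel is `η / (π (y - t)²)` with an error cubic in
`η`. Hence `U(y + iη) = α - πηρ(y) + O(log n / n + η³)` with `ρ(y) = π⁻² ∫_{Iᶜ} (α - U) / (y - t)²`
(`abs_nodePotential_sub_le`). The growth of `U` being logarithmic, `ρ` is bounded and Lipschitz away
from the endpoints. It is bounded below because `α - U` is nowhere very negative on average and is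
at least `1` on a fixed interval far out (`le_potentialDensity`).

For (iii) and (iv), the difference `U(y + iη) - U(y + 2iη)` eliminates `α`: it is `πηρ(y)` up to
error, and also an average over the nodes of a positive kernel. Positivity gives (iii)
(`inv_mul_sum_cauchyBump_le`). Integrating over `J` with `η = K log n / n` compares `∫_J ρ` with a
smoothed count of nodes in `J`; the smoothing error is dominated by bumps that the previous bound
controls (`abs_indicator_sub_smoothedStep_le`), which gives (iv). -/

/-! ### The Lebesgue function and the equilibrium constant. -/

theorem one_le_lebesgueFunction {n : ℕ} (hn : 0 < n) {x : Fin n → ℝ}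
    (hx : Function.Injective x) (t : ℝ) : 1 ≤ lebesgueFunction x t := by
  have : Nonempty (Fin n) := ⟨⟨0, hn⟩⟩
  have h := Lagrange.sum_basis (s := Finset.univ) (v := x) hx.injOn Finset.univ_nonempty
  have h1 : ∑ k, (Lagrange.basis Finset.univ x k).eval t = 1 := by
    rw [← Polynomial.eval_finsetSum, h, Polynomial.eval_one]
  calc (1 : ℝ) = |∑ k, (Lagrange.basis Finset.univ x k).eval t| := by rw [h1, abs_one]
    _ ≤ _ := Finset.abs_sum_le_sum_abs _ _

theorem nodeDistance_le {n : ℕ} (x : Fin n → ℝ) (t : ℝ) (i : Fin n) :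
    nodeDistance x t ≤ |t - x i| :=
  ciInf_le (Set.finite_range _).bddBelow i

theorem exists_nodeDistance_eq {n : ℕ} (hn : 0 < n) (x : Fin n → ℝ) (t : ℝ) :
    ∃ i, nodeDistance x t = |t - x i| := by
  have : Nonempty (Fin n) := ⟨⟨0, hn⟩⟩
  obtain ⟨i, hi⟩ := exists_eq_ciInf_of_finite (f := fun i => |t - x i|)
  exact ⟨i, hi.symm⟩

theorem nodeDistance_pos {n : ℕ} (hn : 0 < n) {x : Fin n → ℝ} {t : ℝ} (ht : t ∉ Set.range x) :
    0 < nodeDistance x t := by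
  obtain ⟨i, hi⟩ := exists_nodeDistance_eq hn x t
  rw [hi, abs_pos, sub_ne_zero]
  exact fun h => ht ⟨i, h.symm⟩

theorem nodeDistance_node {n : ℕ} (x : Fin n → ℝ) (i : Fin n) : nodeDistance x (x i) = 0 := by
  apply le_antisymm
  · simpa using nodeDistance_le x (x i) i
  · exact Real.iInf_nonneg fun j => abs_nonneg _

theorem nodePolynomial_eval {n : ℕ} (x : Fin n → ℝ) (t : ℝ) :
    (nodePolynomial x).eval t = ∏ i, (t - x i) := Lagrange.eval_nodal ..

/-- A polynomially bounded Lebesgue function forces `|P|` to be almost constant on the set,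
away from the nodes; the lower bound is valid on the whole line. -/
theorem exists_equilibrium_constant {n : ℕ} (hn : 0 < n) {x : Fin n → ℝ}
    (hx : Function.Injective x) (hx1 : ∀ i, x i ∈ Set.Icc (-1 : ℝ) 1) {I : Set ℝ}
    (hI1 : I ⊆ Set.Icc (-1) 1) {Λ : ℝ} (hΛ : 0 ≤ Λ) (hlam : ∀ t ∈ I, lebesgueFunction x t ≤ Λ) :
    ∃ α : ℝ, (∀ t, nodeDistance x t * Real.exp (-(n * α)) ≤ |(nodePolynomial x).eval t|) ∧
      ∀ t ∈ I, |(nodePolynomial x).eval t| ≤ 2 * Λ * n * Real.exp (-(n * α)) := by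
  have : Nonempty (Fin n) := ⟨⟨0, hn⟩⟩
  have hn' : (0 : ℝ) < n := by exact_mod_cast hn
  set w : Fin n → ℝ := fun k => |Lagrange.nodalWeight Finset.univ x k| with hw
  have hwpos : ∀ k, 0 < w k := fun k =>
    abs_pos.2 (Lagrange.nodalWeight_ne_zero hx.injOn (Finset.mem_univ k))
  -- The largest weight defines the constant: `exp (n * α) = n * w k₀`.
  obtain ⟨k₀, hk₀⟩ := Finite.exists_max w
  have hM := hwpos k₀
  have hexp : Real.exp (-(n * (Real.log (n * w k₀) / n))) = (n * w k₀)⁻¹ := by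
    rw [mul_div_cancel₀ _ hn'.ne', Real.exp_neg, Real.exp_log (by positivity)]
  have hbasis : ∀ t, t ∉ Set.range x → ∀ k, |(Lagrange.basis Finset.univ x k).eval t| =
      |(nodePolynomial x).eval t| * (w k * |t - x k|⁻¹) := by
    intro t ht k
    rw [Lagrange.eval_basis_not_at_node (Finset.mem_univ k) (fun h => ht ⟨k, h.symm⟩), abs_mul,
      abs_mul, abs_inv]
    rfl
  refine ⟨Real.log (n * w k₀) / n, fun t => ?_, fun t ht => ?_⟩
  · rw [hexp]
    by_cases htn : t ∈ Set.range x
    · obtain ⟨i, rfl⟩ := htn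
      rw [nodeDistance_node, zero_mul]; exact abs_nonneg _
    · have hδ := nodeDistance_pos hn htn
      have h1 : (1 : ℝ) ≤ ∑ k : Fin n,
          |(nodePolynomial x).eval t| * (w k₀ * (nodeDistance x t)⁻¹) := by
        refine (one_le_lebesgueFunction hn hx t).trans (Finset.sum_le_sum fun k _ => ?_)
        rw [hbasis t htn k]
        have := nodeDistance_le x t k
        have := hk₀ k
        gcongr
      rw [Finset.sum_const, Finset.card_univ, Fintype.card_fin, nsmul_eq_mul] at h1
      rw [← div_eq_mul_inv, div_le_iff₀ (by positivity)]
      calc nodeDistance x t = nodeDistance x t * 1 := (mul_one _).symm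
        _ ≤ nodeDistance x t *
            (n * (|(nodePolynomial x).eval t| * (w k₀ * (nodeDistance x t)⁻¹))) := by gcongr
        _ = _ := by field_simp
  · rw [hexp]
    by_cases htn : t ∈ Set.range x
    · obtain ⟨i, rfl⟩ := htn
      rw [nodePolynomial, Lagrange.eval_nodal_at_node (Finset.mem_univ i), abs_zero]
      positivity
    -- The term `k₀` of the Lebesgue function alone already bounds `|P|` from above.
    · have h1 : |(nodePolynomial x).eval t| * (w k₀ * |t - x k₀|⁻¹) ≤ Λ := by
        rw [← hbasis t htn k₀]
        exact (Finset.single_le_sum (f := fun k => |(Lagrange.basis Finset.univ x k).eval t|)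
          (fun k _ => abs_nonneg _) (Finset.mem_univ k₀)).trans (hlam t ht)
      have hpos : 0 < |t - x k₀| := by
        rw [abs_pos, sub_ne_zero]; exact fun h => htn ⟨k₀, h.symm⟩
      have hle : |t - x k₀| ≤ 2 := by
        have h2 := hI1 ht
        have h3 := hx1 k₀
        rw [abs_le]; constructor <;> linarith [h2.1, h2.2, h3.1, h3.2]
      rw [← mul_assoc, ← div_eq_mul_inv, div_le_iff₀ hpos] at h1
      calc |(nodePolynomial x).eval t|
          = |(nodePolynomial x).eval t| * w k₀ / w k₀ := by field_simp
        _ ≤ Λ * 2 / w k₀ :=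
            div_le_div_of_nonneg_right (h1.trans (mul_le_mul_of_nonneg_left hle hΛ)) hM.le
        _ = _ := by field_simp

/-! ### The half-plane Poisson formula for the logarithm. -/

/-- The Poisson kernel of the upper half-plane at the point `x + iη`. -/
noncomputable def halfPlanePoisson (x η t : ℝ) : ℝ := η / (Real.pi * ((x - t) ^ 2 + η ^ 2))

theorem image_add_mul_tan (x : ℝ) {η : ℝ} (hη : 0 < η) :
    (fun φ => x + η * Real.tan φ) '' Set.Ioo (-(Real.pi / 2)) (Real.pi / 2) = Set.univ := by
  refine Set.eq_univ_of_forall fun t => ?_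
  refine ⟨Real.arctan ((t - x) / η), ⟨Real.neg_pi_div_two_lt_arctan _,
    Real.arctan_lt_pi_div_two _⟩, ?_⟩
  simp only [Real.tan_arctan]
  field_simp
  ring

theorem injOn_add_mul_tan (x : ℝ) {η : ℝ} (hη : 0 < η) :
    Set.InjOn (fun φ => x + η * Real.tan φ) (Set.Ioo (-(Real.pi / 2)) (Real.pi / 2)) := by
  intro a ha b hb h
  exact Real.injOn_tan ha hb (mul_left_cancel₀ hη.ne' (add_left_cancel h))

theorem hasDerivAt_add_mul_tan (x η : ℝ) {φ : ℝ}
    (hφ : φ ∈ Set.Ioo (-(Real.pi / 2)) (Real.pi / 2)) :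
    HasDerivAt (fun φ => x + η * Real.tan φ) (η * (1 / Real.cos φ ^ 2)) φ :=
  ((Real.hasDerivAt_tan (Real.cos_pos_of_mem_Ioo hφ).ne').const_mul η).const_add x

/-- The substitution `t = x + η tan φ` turns Poisson measure into uniform measure on an interval of
length `π`. -/
theorem halfPlanePoisson_tan (x : ℝ) {η : ℝ} (hη : 0 < η) {φ : ℝ}
    (hφ : φ ∈ Set.Ioo (-(Real.pi / 2)) (Real.pi / 2)) :
    |η * (1 / Real.cos φ ^ 2)| * halfPlanePoisson x η (x + η * Real.tan φ) = 1 / Real.pi := by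
  have hc := Real.cos_pos_of_mem_Ioo hφ
  rw [abs_of_pos (by positivity), halfPlanePoisson, Real.tan_eq_sin_div_cos]
  have h1 : (x - (x + η * (Real.sin φ / Real.cos φ))) ^ 2 + η ^ 2 = η ^ 2 / Real.cos φ ^ 2 := by
    have := Real.sin_sq_add_cos_sq φ
    field_simp
    linear_combination η ^ 2 * this
  rw [h1]
  field_simp

theorem integrable_halfPlanePoisson_mul_iff (x : ℝ) {η : ℝ} (hη : 0 < η) (f : ℝ → ℝ) :
    Integrable (fun t => halfPlanePoisson x η t * f t) ↔
      IntegrableOn (fun φ => 1 / Real.pi * f (x + η * Real.tan φ))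
        (Set.Ioo (-(Real.pi / 2)) (Real.pi / 2)) := by
  have h := integrableOn_image_iff_integrableOn_abs_deriv_smul measurableSet_Ioo
    (fun φ hφ => (hasDerivAt_add_mul_tan x η hφ).hasDerivWithinAt) (injOn_add_mul_tan x hη)
    (fun t => halfPlanePoisson x η t * f t)
  rw [image_add_mul_tan x hη, integrableOn_univ] at h
  rw [h]
  refine integrableOn_congr_fun (fun φ hφ => ?_) measurableSet_Ioo
  simp only [smul_eq_mul]
  rw [← mul_assoc, halfPlanePoisson_tan x hη hφ]

theorem integral_halfPlanePoisson_mul (x : ℝ) {η : ℝ} (hη : 0 < η) (f : ℝ → ℝ) :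
    ∫ t, halfPlanePoisson x η t * f t =
      ∫ φ in Set.Ioo (-(Real.pi / 2)) (Real.pi / 2), 1 / Real.pi * f (x + η * Real.tan φ) := by
  have h := integral_image_eq_integral_abs_deriv_smul measurableSet_Ioo
    (fun φ hφ => (hasDerivAt_add_mul_tan x η hφ).hasDerivWithinAt) (injOn_add_mul_tan x hη)
    (fun t => halfPlanePoisson x η t * f t)
  rw [image_add_mul_tan x hη, Measure.restrict_univ] at h
  rw [h]
  refine setIntegral_congr_fun measurableSet_Ioo (fun φ hφ => ?_)
  simp only [smul_eq_mul]
  rw [← mul_assoc, halfPlanePoisson_tan x hη hφ]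

theorem integrable_halfPlanePoisson (x : ℝ) {η : ℝ} (hη : 0 < η) :
    Integrable (halfPlanePoisson x η) := by
  have := (integrable_halfPlanePoisson_mul_iff x hη (fun _ => 1)).2
    (by simp [integrableOn_const_iff])
  simpa using this

theorem integral_halfPlanePoisson (x : ℝ) {η : ℝ} (hη : 0 < η) :
    ∫ t, halfPlanePoisson x η t = 1 := by
  have := integral_halfPlanePoisson_mul x hη (fun _ => 1)
  simp only [mul_one] at this
  rw [this]
  simp [Real.pi_pos.le, Real.pi_ne_zero]

theorem integrableOn_log_cos_sub (θ : ℝ) :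
    IntegrableOn (fun φ => Real.log (Real.cos (φ - θ)))
      (Set.Ioo (-(Real.pi / 2)) (Real.pi / 2)) := by
  have h : IntervalIntegrable (Real.log ∘ Real.cos) volume (-(Real.pi / 2) - θ)
    (Real.pi / 2 - θ) := intervalIntegrable_log_cos
  have h2 := h.comp_sub_right θ
  simp only [sub_add_cancel] at h2
  rw [intervalIntegrable_iff_integrableOn_Ioo_of_le (by linarith [Real.pi_pos])] at h2
  exact h2

theorem integral_log_cos_sub (θ : ℝ) :
    ∫ φ in Set.Ioo (-(Real.pi / 2)) (Real.pi / 2), Real.log (Real.cos (φ - θ)) =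
      ∫ φ in Set.Ioo (-(Real.pi / 2)) (Real.pi / 2), Real.log (Real.cos φ) := by
  have hle : -(Real.pi / 2) ≤ Real.pi / 2 := by linarith [Real.pi_pos]
  rw [← integral_Ioc_eq_integral_Ioo, ← integral_Ioc_eq_integral_Ioo,
    ← intervalIntegral.integral_of_le hle, ← intervalIntegral.integral_of_le hle,
    intervalIntegral.integral_comp_sub_right (fun φ => Real.log (Real.cos φ))]
  -- The period is `π` rather than `2π` because `Real.log` is even.
  have hper : Function.Periodic (fun φ => Real.log (Real.cos φ)) Real.pi := by
    intro φ
    simp [Real.cos_add_pi]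
  have := hper.intervalIntegral_add_eq (-(Real.pi / 2) - θ) (-(Real.pi / 2))
  convert this using 2 <;> ring

/-- With `z = (x - s) + iη` and `θ = arg z`, one has `x + η tan φ - s = |z| cos (φ - θ) / cos φ`.
After integration the two `log cos` terms cancel by periodicity. The zero of the left side is
excluded, since `Real.log 0 = 0` breaks the identity there. -/
theorem log_add_mul_tan_sub (x s : ℝ) {η : ℝ} (hη : 0 < η) :
    ∃ θ : ℝ, (fun φ => 1 / Real.pi * Real.log (x + η * Real.tan φ - s)) =ᵐ[volume.restrict
      (Set.Ioo (-(Real.pi / 2)) (Real.pi / 2))]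
      fun φ => 1 / Real.pi * (1 / 2 * Real.log ((x - s) ^ 2 + η ^ 2)
        + Real.log (Real.cos (φ - θ)) - Real.log (Real.cos φ)) := by
  set z : ℂ := ⟨x - s, η⟩ with hz
  refine ⟨z.arg, ?_⟩
  have hnorm : ‖z‖ ^ 2 = (x - s) ^ 2 + η ^ 2 := by
    rw [← Complex.normSq_eq_norm_sq, Complex.normSq_apply]; simp [hz]; ring
  have hpos : 0 < ‖z‖ := by
    rw [norm_pos_iff]; intro h
    have := congrArg Complex.im h
    simp [hz] at this; exact hη.ne' this
  have hre : ‖z‖ * Real.cos z.arg = x - s := Complex.norm_mul_cos_arg z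
  have him : ‖z‖ * Real.sin z.arg = η := Complex.norm_mul_sin_arg z
  have hae : ∀ᵐ φ : ℝ, φ ≠ Real.arctan ((s - x) / η) := by
    rw [ae_iff]; simp
  filter_upwards [ae_restrict_mem measurableSet_Ioo, ae_restrict_of_ae hae] with φ hφ hne
  have hc := Real.cos_pos_of_mem_Ioo hφ
  have hnum : x + η * Real.tan φ - s = ‖z‖ * Real.cos (φ - z.arg) / Real.cos φ := by
    rw [Real.cos_sub, Real.tan_eq_sin_div_cos]
    field_simp
    linear_combination -Real.cos φ * hre - Real.sin φ * him
  have hne0 : Real.cos (φ - z.arg) ≠ 0 := by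
    intro h0
    rw [h0, mul_zero, zero_div] at hnum
    apply hne
    have : (s - x) / η = Real.tan φ := by field_simp; linarith
    rw [this, Real.arctan_tan hφ.1 hφ.2]
  rw [hnum, Real.log_div (mul_ne_zero hpos.ne' hne0) hc.ne', Real.log_mul hpos.ne' hne0, ← hnorm,
    Real.log_pow]
  push_cast
  ring

theorem integrable_halfPlanePoisson_mul_log (x s : ℝ) {η : ℝ} (hη : 0 < η) :
    Integrable (fun t => halfPlanePoisson x η t * Real.log (t - s)) := by
  rw [integrable_halfPlanePoisson_mul_iff x hη (fun t => Real.log (t - s))]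
  obtain ⟨θ, hθ⟩ := log_add_mul_tan_sub x s hη
  rw [IntegrableOn, integrable_congr hθ]
  refine Integrable.const_mul (Integrable.sub (Integrable.add ?_ (integrableOn_log_cos_sub θ)) ?_) _
  · exact integrableOn_const measure_Ioo_lt_top.ne
  · have h0 := integrableOn_log_cos_sub 0
    simp only [sub_zero] at h0
    exact h0

/-- The Poisson formula for `log |· - s|` in the upper half-plane. -/
theorem integral_halfPlanePoisson_mul_log (x s : ℝ) {η : ℝ} (hη : 0 < η) :
    ∫ t, halfPlanePoisson x η t * Real.log (t - s) = 1 / 2 * Real.log ((x - s) ^ 2 + η ^ 2) := by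
  rw [integral_halfPlanePoisson_mul x hη (fun t => Real.log (t - s))]
  obtain ⟨θ, hθ⟩ := log_add_mul_tan_sub x s hη
  have hc : IntegrableOn (fun φ => Real.log (Real.cos φ))
      (Set.Ioo (-(Real.pi / 2)) (Real.pi / 2)) := by simpa using integrableOn_log_cos_sub 0
  have hk : IntegrableOn (fun _ => 1 / 2 * Real.log ((x - s) ^ 2 + η ^ 2))
      (Set.Ioo (-(Real.pi / 2)) (Real.pi / 2)) := integrableOn_const measure_Ioo_lt_top.ne
  rw [integral_congr_ae hθ, integral_const_mul,
    integral_sub (f := fun φ => 1 / 2 * Real.log ((x - s) ^ 2 + η ^ 2)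
      + Real.log (Real.cos (φ - θ))) (hk.add (integrableOn_log_cos_sub θ)) hc,
    integral_add hk (integrableOn_log_cos_sub θ), integral_log_cos_sub]
  simp only [add_sub_cancel_right, integral_const, smul_eq_mul, measureReal_restrict_apply_univ,
    Real.volume_real_Ioo]
  rw [max_eq_left (by linarith [Real.pi_pos])]
  have := Real.pi_ne_zero
  field_simp
  ring

/-! ### The potential of the nodes and its Poisson representation. -/

/-- The logarithmic potential of the empirical measure at the point `t + iη`. -/
noncomputable def nodePotential {n : ℕ} (x : Fin n → ℝ) (t η : ℝ) : ℝ :=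
  -((n : ℝ)⁻¹ * ∑ i, 1 / 2 * Real.log ((t - x i) ^ 2 + η ^ 2))

theorem integral_empiricalMeasure {n : ℕ} (x : Fin n → ℝ) (f : ℝ → ℝ) :
    ∫ t, f t ∂(empiricalMeasure x) = (n : ℝ)⁻¹ * ∑ i, f (x i) := by
  rw [empiricalMeasure, integral_smul_measure,
    integral_finsetSum_measure (fun i _ => integrable_dirac (by simp))]
  simp

theorem empiricalMeasure_real {n : ℕ} (x : Fin n → ℝ) {s : Set ℝ} (hs : MeasurableSet s) :
    (empiricalMeasure x).real s = (n : ℝ)⁻¹ * ∑ i, s.indicator (fun _ => (1 : ℝ)) (x i) := by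
  rw [← integral_empiricalMeasure]
  exact (integral_indicator_one hs).symm

theorem logPotential_empiricalMeasure {n : ℕ} (x : Fin n → ℝ) (z : ℂ) :
    logPotential (empiricalMeasure x) z = nodePotential x z.re z.im := by
  rw [logPotential, integral_empiricalMeasure, nodePotential, ← mul_neg, ← Finset.sum_neg_distrib]
  congr 1
  refine Finset.sum_congr rfl fun i _ => ?_
  have h : ‖z - (x i : ℂ)‖ ^ 2 = (z.re - x i) ^ 2 + z.im ^ 2 := by
    rw [← Complex.normSq_eq_norm_sq, Complex.normSq_apply]; simp; ring
  rw [← h, Real.log_pow, one_div, Real.log_inv]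
  push_cast
  ring

theorem nodePotential_zero {n : ℕ} (x : Fin n → ℝ) (t : ℝ) :
    nodePotential x t 0 = -((n : ℝ)⁻¹ * ∑ i, Real.log (t - x i)) := by
  rw [nodePotential]
  congr 2
  refine Finset.sum_congr rfl fun i _ => ?_
  rw [zero_pow two_ne_zero, add_zero, Real.log_pow]
  push_cast
  ring

theorem measurable_nodePotential_zero {n : ℕ} (x : Fin n → ℝ) :
    Measurable fun t => nodePotential x t 0 := by
  simp only [nodePotential]
  fun_prop

theorem halfPlanePoisson_mul_nodePotential {n : ℕ} (x : Fin n → ℝ) (t η s : ℝ) :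
    halfPlanePoisson t η s * nodePotential x s 0 =
      -((n : ℝ)⁻¹ * ∑ i, halfPlanePoisson t η s * Real.log (s - x i)) := by
  rw [nodePotential_zero, ← Finset.mul_sum]; ring

theorem integrable_halfPlanePoisson_mul_nodePotential {n : ℕ} (x : Fin n → ℝ) (t : ℝ) {η : ℝ}
    (hη : 0 < η) : Integrable fun s => halfPlanePoisson t η s * nodePotential x s 0 := by
  simp only [halfPlanePoisson_mul_nodePotential]
  exact ((integrable_finsetSum _ fun i _ =>
    integrable_halfPlanePoisson_mul_log t (x i) hη).const_mul _).neg

theorem integral_halfPlanePoisson_mul_nodePotential {n : ℕ} (x : Fin n → ℝ) (t : ℝ) {η : ℝ}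
    (hη : 0 < η) :
    ∫ s, halfPlanePoisson t η s * nodePotential x s 0 = nodePotential x t η := by
  simp only [halfPlanePoisson_mul_nodePotential]
  rw [integral_neg, integral_const_mul, integral_finsetSum _ fun i _ =>
    integrable_halfPlanePoisson_mul_log t (x i) hη]
  simp only [integral_halfPlanePoisson_mul_log _ _ hη, nodePotential]

theorem nodePotential_eq_log_nodePolynomial {n : ℕ} (x : Fin n → ℝ) {t : ℝ}
    (ht : t ∉ Set.range x) :
    nodePotential x t 0 = -((n : ℝ)⁻¹ * Real.log |(nodePolynomial x).eval t|) := by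
  rw [nodePotential_zero, Real.log_abs, nodePolynomial_eval, Real.log_prod]
  exact fun i _ => sub_ne_zero.2 fun h => ht ⟨i, h.symm⟩

theorem nodePotential_le_of_le {n : ℕ} (hn : 0 < n) {x : Fin n → ℝ} {α t : ℝ}
    (ht : t ∉ Set.range x)
    (h : nodeDistance x t * Real.exp (-(n * α)) ≤ |(nodePolynomial x).eval t|) :
    nodePotential x t 0 ≤ α + Real.log (1 / nodeDistance x t) / n := by
  have hn' : (0 : ℝ) < n := by exact_mod_cast hn
  have hδ := nodeDistance_pos hn ht
  have h1 := Real.log_le_log (by positivity) h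
  rw [Real.log_mul hδ.ne' (Real.exp_pos _).ne', Real.log_exp] at h1
  rw [nodePotential_eq_log_nodePolynomial x ht, one_div, Real.log_inv]
  have h2 : (n : ℝ)⁻¹ * (Real.log (nodeDistance x t) + -(n * α)) ≤
      (n : ℝ)⁻¹ * Real.log |(nodePolynomial x).eval t| := by gcongr
  have h3 : (n : ℝ)⁻¹ * (Real.log (nodeDistance x t) + -(n * α)) =
      Real.log (nodeDistance x t) / n - α := by field_simp; ring
  rw [neg_div]
  linarith

theorem le_nodePotential_of_le {n : ℕ} (hn : 0 < n) {x : Fin n → ℝ} {α M t : ℝ} (hM : 0 < M)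
    (ht : t ∉ Set.range x)
    (h : |(nodePolynomial x).eval t| ≤ M * Real.exp (-(n * α))) :
    α - Real.log M / n ≤ nodePotential x t 0 := by
  have hn' : (0 : ℝ) < n := by exact_mod_cast hn
  have hP : 0 < |(nodePolynomial x).eval t| := by
    rw [abs_pos, nodePolynomial_eval, Finset.prod_ne_zero_iff]
    exact fun i _ => sub_ne_zero.2 fun h => ht ⟨i, h.symm⟩
  have h1 := Real.log_le_log hP h
  rw [Real.log_mul hM.ne' (Real.exp_pos _).ne', Real.log_exp] at h1
  rw [nodePotential_eq_log_nodePolynomial x ht]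
  have h2 : (n : ℝ)⁻¹ * Real.log |(nodePolynomial x).eval t| ≤
    (n : ℝ)⁻¹ * (Real.log M + -(n * α)) := by gcongr
  have h3 : (n : ℝ)⁻¹ * (Real.log M + -(n * α)) = Real.log M / n - α := by field_simp; ring
  linarith

/-! ### Averaging the logarithmic peaks at the nodes. -/

/-- The integrable singularity `|v|^{-1/2}`, cut off to `[-1, 1]`. -/
noncomputable def spike (v : ℝ) : ℝ :=
  (Set.Icc (-1 : ℝ) 1).indicator (fun v => |v| ^ (-(1 / 2) : ℝ)) v

theorem spike_nonneg (v : ℝ) : 0 ≤ spike v :=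
  Set.indicator_nonneg (fun _ _ => by positivity) v

theorem integrable_spike : Integrable spike := by
  have h : IntegrableOn (fun v : ℝ => |v| ^ (-(1 / 2) : ℝ)) (Set.Ioc 0 1) := by
    have h1 : IntervalIntegrable (fun v : ℝ => v ^ (-(1 / 2) : ℝ)) volume 0 1 :=
      intervalIntegral.intervalIntegrable_rpow' (by norm_num)
    rw [intervalIntegrable_iff_integrableOn_Ioc_of_le zero_le_one] at h1
    refine h1.congr_fun (fun v hv => ?_) measurableSet_Ioc
    simp only [abs_of_pos hv.1]
  have h' : IntervalIntegrable (fun v : ℝ => |v| ^ (-(1 / 2) : ℝ)) volume 0 1 := by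
    rwa [intervalIntegrable_iff_integrableOn_Ioc_of_le zero_le_one]
  have h2 : IntervalIntegrable (fun v : ℝ => |v| ^ (-(1 / 2) : ℝ)) volume (-1) 0 := by
    have := h'.comp_mul_left (c := -1)
    simp only [neg_mul, one_mul, abs_neg] at this
    simpa using this.symm
  have h3 := h2.trans h'
  rw [intervalIntegrable_iff_integrableOn_Icc_of_le (by norm_num)] at h3
  exact (integrable_indicator_iff measurableSet_Icc).2 h3

/-- A bound for `n⁻¹ log (1 / δ)` with explicitly small integral. -/
noncomputable def nodeError {n : ℕ} (x : Fin n → ℝ) (t : ℝ) : ℝ :=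
  (4 * Real.log n + 2 / n ^ 2 * ∑ i, spike (t - x i)) / n

theorem nodeError_nonneg {n : ℕ} (x : Fin n → ℝ) (t : ℝ) : 0 ≤ nodeError x t := by
  have : 0 ≤ Real.log n := Real.log_natCast_nonneg n
  have : 0 ≤ ∑ i, spike (t - x i) := Finset.sum_nonneg fun i _ => spike_nonneg _
  unfold nodeError
  positivity

theorem log_le_log_add_div {a y : ℝ} (ha : 0 < a) (hy : 0 < y) :
    Real.log y ≤ Real.log a + y / a := by
  have h := Real.log_le_sub_one_of_pos (div_pos hy ha)
  rw [Real.log_div hy.ne' ha.ne'] at h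
  linarith

theorem log_nodeDistance_le_nodeError {n : ℕ} (hn : 0 < n) {x : Fin n → ℝ} {t : ℝ}
    (ht : t ∉ Set.range x) : Real.log (1 / nodeDistance x t) / n ≤ nodeError x t := by
  have hn' : (0 : ℝ) < n := by exact_mod_cast hn
  have hδ := nodeDistance_pos hn ht
  rcases le_or_gt 1 (nodeDistance x t) with h1 | h1
  · refine le_trans ?_ (nodeError_nonneg x t)
    refine div_nonpos_of_nonpos_of_nonneg ?_ hn'.le
    exact Real.log_nonpos (by positivity) ((div_le_one hδ).2 h1)
  · obtain ⟨i, hi⟩ := exists_nodeDistance_eq hn x t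
    unfold nodeError
    gcongr
    have hsp : spike (t - x i) = nodeDistance x t ^ (-(1 / 2) : ℝ) := by
      rw [hi, spike, Set.indicator_of_mem]
      rw [hi, abs_lt] at h1
      exact ⟨h1.1.le, h1.2.le⟩
    have hle : spike (t - x i) ≤ ∑ i, spike (t - x i) :=
      Finset.single_le_sum (f := fun i => spike (t - x i)) (fun i _ => spike_nonneg _)
        (Finset.mem_univ i)
    have h2 : Real.log (1 / nodeDistance x t) = 2 * Real.log (spike (t - x i)) := by
      rw [hsp, Real.log_rpow hδ, one_div, Real.log_inv]; ring
    have hsp0 : 0 < spike (t - x i) := by rw [hsp]; positivity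
    -- The tangent to `log` at `n ^ 2` trades the peak for `2 log n` plus `n⁻²` times an integrable
    -- spike, cheap even after summing over all `n` nodes.
    have h3 := log_le_log_add_div (a := (n : ℝ) ^ 2) (by positivity) hsp0
    rw [Real.log_pow] at h3
    push_cast at h3
    calc Real.log (1 / nodeDistance x t) = 2 * Real.log (spike (t - x i)) := h2
      _ ≤ 2 * (2 * Real.log n + spike (t - x i) / n ^ 2) := by gcongr
      _ = 4 * Real.log n + 2 / n ^ 2 * spike (t - x i) := by ring
      _ ≤ _ := by gcongr

theorem integrable_mul_spike {w : ℝ → ℝ} (hw : Integrable w) {W : ℝ} (hW : ∀ t, |w t| ≤ W)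
    (s : ℝ) : Integrable fun t => w t * spike (t - s) :=
  (integrable_spike.comp_sub_right s).bdd_mul hw.aestronglyMeasurable (ae_of_all _ hW)

theorem mul_nodeError_eq {n : ℕ} (x : Fin n → ℝ) (w : ℝ → ℝ) (t : ℝ) :
    w t * nodeError x t = 4 * (Real.log n / n) * w t
      + 2 / n ^ 2 / n * ∑ i, w t * spike (t - x i) := by
  rw [nodeError, ← Finset.mul_sum]; ring

theorem integrable_mul_nodeError {n : ℕ} (x : Fin n → ℝ) {w : ℝ → ℝ} (hw : Integrable w) {W : ℝ}
    (hW : ∀ t, |w t| ≤ W) : Integrable fun t => w t * nodeError x t := by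
  simp only [mul_nodeError_eq]
  exact (hw.const_mul _).add
    ((integrable_finsetSum _ fun i _ => integrable_mul_spike hw hW (x i)).const_mul _)

/-- The constant part of the error sees only the mass of `w`, the spikes only its supremum. A weight
of bounded mass and height at most `n` therefore costs `O(log n / n)`. -/
theorem integral_mul_nodeError_le {n : ℕ} (hn : 3 ≤ n) (x : Fin n → ℝ) {w : ℝ → ℝ}
    (hw : Integrable w) {W : ℝ} (hW : ∀ t, |w t| ≤ W) :
    ∫ t, w t * nodeError x t ≤
      (4 + 2 * ∫ v, spike v) * (Real.log n / n) * (|∫ t, w t| + W / n) := by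
  have hn' : (0 : ℝ) < n := by exact_mod_cast (by lia : 0 < n)
  have hlog : 1 ≤ Real.log n := by
    rw [Real.le_log_iff_exp_le hn']
    have : (3 : ℝ) ≤ n := by exact_mod_cast hn
    linarith [Real.exp_one_lt_d9]
  have hW0 : 0 ≤ W := (abs_nonneg _).trans (hW 0)
  have hH : 0 ≤ ∫ v, spike v := integral_nonneg spike_nonneg
  simp only [mul_nodeError_eq]
  rw [integral_add (hw.const_mul _)
    ((integrable_finsetSum _ fun i _ => integrable_mul_spike hw hW (x i)).const_mul _),
    integral_const_mul, integral_const_mul,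
    integral_finsetSum _ fun i _ => integrable_mul_spike hw hW (x i)]
  have h1 : ∀ i, ∫ t, w t * spike (t - x i) ≤ W * ∫ v, spike v := by
    intro i
    rw [← integral_sub_right_eq_self (μ := volume) spike (x i), ← integral_const_mul]
    refine integral_mono (integrable_mul_spike hw hW (x i))
      ((integrable_spike.comp_sub_right (x i)).const_mul _) fun t => ?_
    exact mul_le_mul_of_nonneg_right ((le_abs_self _).trans (hW t)) (spike_nonneg _)
  have h2 : ∑ i, ∫ t, w t * spike (t - x i) ≤ n * (W * ∫ v, spike v) := by
    refine (Finset.sum_le_sum fun i _ => h1 i).trans ?_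
    simp
  calc 4 * (Real.log n / n) * (∫ t, w t) + 2 / n ^ 2 / n * ∑ i, ∫ t, w t * spike (t - x i)
      ≤ 4 * (Real.log n / n) * |∫ t, w t| + 2 / n ^ 2 / n * (n * (W * ∫ v, spike v)) := by
        gcongr
        exact le_abs_self _
    _ = 4 * (Real.log n / n) * |∫ t, w t| + 2 * (∫ v, spike v) * (1 / n) * (W / n) := by
        field_simp
    _ ≤ 4 * (Real.log n / n) * |∫ t, w t| + 2 * (∫ v, spike v) * (Real.log n / n) * (W / n) := by
        gcongr
    _ ≤ _ := by
        have a1 : 0 ≤ (∫ v, spike v) * (Real.log n / n) * |∫ t, w t| := by positivity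
        have a2 : 0 ≤ Real.log n / n * (W / n) := by positivity
        linarith

/-! ### Inverse-square weights away from the singularity. -/

/-- The logarithm with an integrable weight. -/
noncomputable def weightedLog (v : ℝ) : ℝ := |Real.log v| / (1 + v ^ 2)

theorem weightedLog_nonneg (v : ℝ) : 0 ≤ weightedLog v := by unfold weightedLog; positivity

theorem integrable_weightedLog : Integrable weightedLog := by
  have h := (integrable_halfPlanePoisson_mul_log 0 0 one_pos).abs.const_mul Real.pi
  refine h.congr (ae_of_all _ fun v => ?_)
  have hπ := Real.pi_pos
  have h1 : 0 < halfPlanePoisson 0 1 v := by unfold halfPlanePoisson; positivity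
  beta_reduce
  rw [abs_mul, abs_of_pos h1, sub_zero, weightedLog, halfPlanePoisson]
  field_simp
  ring

theorem abs_nodePotential_zero_le {n : ℕ} (x : Fin n → ℝ) (t : ℝ) :
    |nodePotential x t 0| ≤ (n : ℝ)⁻¹ * ∑ i, |Real.log (t - x i)| := by
  rw [nodePotential_zero, abs_neg, abs_mul, abs_of_nonneg (by positivity)]
  gcongr
  exact Finset.abs_sum_le_sum_abs _ _

theorem inv_natCast_mul_sum_const_le {n : ℕ} {f : Fin n → ℝ} {c : ℝ} (hc : 0 ≤ c)
    (hf : ∀ i, f i ≤ c) : (n : ℝ)⁻¹ * ∑ i, f i ≤ c := by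
  rcases Nat.eq_zero_or_pos n with rfl | hn
  · simpa using hc
  have hn' : (0 : ℝ) < n := by exact_mod_cast hn
  calc (n : ℝ)⁻¹ * ∑ i, f i ≤ (n : ℝ)⁻¹ * ∑ i : Fin n, c := by gcongr with i; exact hf i
    _ = c := by simp; field_simp

/-- A common majorant for the potential against the weights `(y - t)⁻²`. -/
noncomputable def potentialMajorant {n : ℕ} (x : Fin n → ℝ) (α t : ℝ) : ℝ :=
  (n : ℝ)⁻¹ * (∑ i, weightedLog (t - x i)) + |α| * (1 + t ^ 2)⁻¹

theorem integrable_potentialMajorant {n : ℕ} (x : Fin n → ℝ) (α : ℝ) :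
    Integrable (potentialMajorant x α) :=
  ((integrable_finsetSum _ fun i _ => integrable_weightedLog.comp_sub_right (x i)).const_mul
    _).add (integrable_inv_one_add_sq.const_mul _)

theorem potentialMajorant_nonneg {n : ℕ} (x : Fin n → ℝ) (α t : ℝ) :
    0 ≤ potentialMajorant x α t := by
  have : 0 ≤ ∑ i, weightedLog (t - x i) := Finset.sum_nonneg fun i _ => weightedLog_nonneg _
  unfold potentialMajorant
  positivity

theorem integral_potentialMajorant_le {n : ℕ} (x : Fin n → ℝ) (α : ℝ) :
    ∫ t, potentialMajorant x α t ≤ (∫ v, weightedLog v) + |α| * Real.pi := by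
  unfold potentialMajorant
  rw [integral_add ((integrable_finsetSum _ fun i _ =>
    integrable_weightedLog.comp_sub_right (x i)).const_mul _)
    (integrable_inv_one_add_sq.const_mul _), integral_const_mul, integral_const_mul,
    integral_finsetSum _ fun i _ => integrable_weightedLog.comp_sub_right (x i),
    integral_univ_inv_one_add_sq]
  gcongr
  refine inv_natCast_mul_sum_const_le (integral_nonneg weightedLog_nonneg) fun i => ?_
  rw [integral_sub_right_eq_self (μ := volume) weightedLog (x i)]

/-- From `t - s = (y - s) - (y - t)` and `|y - s| ≤ 2` one gets `1 + (t - s)² ≤ 9 + 2 (y - t)²`, and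
`9 ≤ (9 / d²) (y - t)²`. This recentres the weight at each node, so the bounds are uniform in `y`
and in the nodes. -/
theorem inv_sq_le_inv_one_add_sq {d y s t : ℝ} (hd : 0 < d) (hy : y ∈ Set.Icc (-1 : ℝ) 1)
    (hs : s ∈ Set.Icc (-1 : ℝ) 1) (ht : d ≤ |y - t|) :
    1 / (y - t) ^ 2 ≤ (9 / d ^ 2 + 2) * (1 / (1 + (t - s) ^ 2)) := by
  have h0 : d ^ 2 ≤ (y - t) ^ 2 := by rw [← sq_abs (y - t)]; gcongr
  have h1 : 0 < (y - t) ^ 2 := lt_of_lt_of_le (by positivity) h0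
  rw [mul_one_div, div_le_div_iff₀ h1 (by positivity), one_mul]
  have h2 : 9 ≤ 9 / d ^ 2 * (y - t) ^ 2 := by
    rw [div_mul_eq_mul_div, le_div_iff₀ (by positivity)]; gcongr
  have h3 : (y - s) ^ 2 ≤ 4 := by
    have : |y - s| ≤ 2 := by
      rw [abs_le]; constructor <;> linarith [hy.1, hy.2, hs.1, hs.2]
    rw [← sq_abs]; nlinarith [abs_nonneg (y - s)]
  nlinarith [sq_nonneg ((y - t) + (y - s))]

theorem abs_potential_div_sq_le {n : ℕ} {x : Fin n → ℝ} (hx1 : ∀ i, x i ∈ Set.Icc (-1 : ℝ) 1)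
    (α : ℝ) {d y t : ℝ} (hd : 0 < d) (hy : y ∈ Set.Icc (-1 : ℝ) 1) (ht : d ≤ |y - t|) :
    |nodePotential x t 0 - α| / (y - t) ^ 2 ≤ (9 / d ^ 2 + 2) * potentialMajorant x α t := by
  have h0 : |nodePotential x t 0 - α| ≤ (n : ℝ)⁻¹ * (∑ i, |Real.log (t - x i)|) + |α| :=
    (abs_sub _ _).trans (by gcongr; exact abs_nodePotential_zero_le x t)
  rw [div_eq_mul_one_div]
  calc |nodePotential x t 0 - α| * (1 / (y - t) ^ 2)
      ≤ ((n : ℝ)⁻¹ * (∑ i, |Real.log (t - x i)|) + |α|) * (1 / (y - t) ^ 2) := by gcongr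
    _ = (n : ℝ)⁻¹ * (∑ i, |Real.log (t - x i)| * (1 / (y - t) ^ 2))
        + |α| * (1 / (y - t) ^ 2) := by rw [← Finset.sum_mul]; ring
    _ ≤ (n : ℝ)⁻¹ * (∑ i, |Real.log (t - x i)| *
          ((9 / d ^ 2 + 2) * (1 / (1 + (t - x i) ^ 2))))
        + |α| * ((9 / d ^ 2 + 2) * (1 / (1 + (t - 0) ^ 2))) := by
        gcongr with i
        · exact inv_sq_le_inv_one_add_sq hd hy (hx1 i) ht
        · exact inv_sq_le_inv_one_add_sq hd hy (by constructor <;> norm_num) ht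
    _ = _ := by
        unfold potentialMajorant weightedLog
        have : ∀ i, |Real.log (t - x i)| * ((9 / d ^ 2 + 2) * (1 / (1 + (t - x i) ^ 2))) =
          (9 / d ^ 2 + 2) * (|Real.log (t - x i)| / (1 + (t - x i) ^ 2)) := fun i => by ring
        simp only [this, ← Finset.mul_sum, sub_zero]
        ring

/-- The off-interval weighted mass of the potential. -/
theorem integrableOn_potential_div_sq {n : ℕ} {x : Fin n → ℝ}
    (hx1 : ∀ i, x i ∈ Set.Icc (-1 : ℝ) 1) (α : ℝ) {S : Set ℝ} (hS : MeasurableSet S) {d y : ℝ}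
    (hd : 0 < d) (hy : y ∈ Set.Icc (-1 : ℝ) 1) (hdS : ∀ t ∈ S, d ≤ |y - t|) :
    IntegrableOn (fun t => |nodePotential x t 0 - α| / (y - t) ^ 2) S := by
  refine ((integrable_potentialMajorant x α).const_mul (9 / d ^ 2 + 2)).integrableOn.mono'
    ?_ ?_
  · have := measurable_nodePotential_zero x
    refine Measurable.aestronglyMeasurable ?_
    have h2 : Measurable fun t => |nodePotential x t 0 - α| := (this.sub_const α).abs
    exact h2.div (by fun_prop)
  · filter_upwards [ae_restrict_mem hS] with t ht
    rw [Real.norm_eq_abs, abs_of_nonneg (by positivity)]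
    exact abs_potential_div_sq_le hx1 α hd hy (hdS t ht)

theorem setIntegral_potential_div_sq_le {n : ℕ} {x : Fin n → ℝ}
    (hx1 : ∀ i, x i ∈ Set.Icc (-1 : ℝ) 1) (α : ℝ) {S : Set ℝ} (hS : MeasurableSet S) {d y : ℝ}
    (hd : 0 < d) (hy : y ∈ Set.Icc (-1 : ℝ) 1) (hdS : ∀ t ∈ S, d ≤ |y - t|) :
    ∫ t in S, |nodePotential x t 0 - α| / (y - t) ^ 2 ≤
      (9 / d ^ 2 + 2) * ((∫ v, weightedLog v) + |α| * Real.pi) := by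
  have hint := (integrable_potentialMajorant x α).const_mul (9 / d ^ 2 + 2)
  calc ∫ t in S, |nodePotential x t 0 - α| / (y - t) ^ 2
      ≤ ∫ t in S, (9 / d ^ 2 + 2) * potentialMajorant x α t :=
        setIntegral_mono_on (integrableOn_potential_div_sq hx1 α hS hd hy hdS)
          hint.integrableOn hS fun t ht => abs_potential_div_sq_le hx1 α hd hy (hdS t ht)
    _ ≤ ∫ t, (9 / d ^ 2 + 2) * potentialMajorant x α t :=
        setIntegral_le_integral hint (ae_of_all _ fun t => by
          have := potentialMajorant_nonneg x α t
          simp only [Pi.zero_apply]; positivity)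
    _ ≤ _ := by
        rw [integral_const_mul]
        gcongr
        exact integral_potentialMajorant_le x α

theorem IntegrableOn.of_abs_div_sq {F : ℝ → ℝ} (hF : Measurable F) {S : Set ℝ} {y : ℝ}
    (h : IntegrableOn (fun t => |F t| / (y - t) ^ 2) S) :
    IntegrableOn (fun t => F t / (y - t) ^ 2) S := by
  refine Integrable.mono' h ?_ (ae_of_all _ fun t => ?_)
  · exact (hF.div (by fun_prop)).aestronglyMeasurable
  · rw [Real.norm_eq_abs, abs_div, abs_of_nonneg (sq_nonneg (y - t))]

/-- Keeping the inverse squares on the right lets the Lipschitz bound for the density reuse the same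
weighted integrals. -/
theorem abs_inv_sq_sub_inv_sq_le {d u v : ℝ} (hd : 0 < d) (hu : d ≤ |u|) (hv : d ≤ |v|) :
    |1 / u ^ 2 - 1 / v ^ 2| ≤ |u - v| / d * (1 / u ^ 2 + 1 / v ^ 2) := by
  have hu0 : u ≠ 0 := abs_pos.1 (hd.trans_le hu)
  have hv0 : v ≠ 0 := abs_pos.1 (hd.trans_le hv)
  have h : 1 / u ^ 2 - 1 / v ^ 2 = -(u - v) * (1 / u ^ 2 * (1 / v) + 1 / v ^ 2 * (1 / u)) := by
    field_simp; ring
  rw [h, abs_mul, abs_neg, show |u - v| / d * (1 / u ^ 2 + 1 / v ^ 2) =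
    |u - v| * ((1 / u ^ 2 + 1 / v ^ 2) / d) by ring]
  refine mul_le_mul_of_nonneg_left ((abs_add_le _ _).trans ?_) (abs_nonneg _)
  rw [abs_mul, abs_mul, abs_of_pos (by positivity : 0 < 1 / u ^ 2),
    abs_of_pos (by positivity : 0 < 1 / v ^ 2), add_div, div_eq_mul_one_div (1 / u ^ 2) d,
    div_eq_mul_one_div (1 / v ^ 2) d, abs_div, abs_div, abs_one]
  gcongr

theorem abs_setIntegral_div_sq_sub_le {F : ℝ → ℝ} (hF : Measurable F) {S : Set ℝ}
    (hS : MeasurableSet S) {d M y z : ℝ} (hd : 0 < d)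
    (hy : ∀ t ∈ S, d ≤ |y - t|) (hz : ∀ t ∈ S, d ≤ |z - t|)
    (hyi : IntegrableOn (fun t => |F t| / (y - t) ^ 2) S)
    (hzi : IntegrableOn (fun t => |F t| / (z - t) ^ 2) S)
    (hyM : ∫ t in S, |F t| / (y - t) ^ 2 ≤ M) (hzM : ∫ t in S, |F t| / (z - t) ^ 2 ≤ M) :
    |(∫ t in S, F t / (y - t) ^ 2) - ∫ t in S, F t / (z - t) ^ 2| ≤ 2 * M / d * |y - z| := by
  rw [← integral_sub (IntegrableOn.of_abs_div_sq hF hyi) (IntegrableOn.of_abs_div_sq hF hzi)]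
  calc |∫ t in S, (F t / (y - t) ^ 2 - F t / (z - t) ^ 2)|
      ≤ ∫ t in S, |F t / (y - t) ^ 2 - F t / (z - t) ^ 2| := abs_integral_le_integral_abs
    _ ≤ ∫ t in S, |y - z| / d * (|F t| / (y - t) ^ 2 + |F t| / (z - t) ^ 2) := by
        refine setIntegral_mono_on ((IntegrableOn.of_abs_div_sq hF hyi).sub
          (IntegrableOn.of_abs_div_sq hF hzi)).abs ((hyi.add hzi).const_mul _) hS fun t ht => ?_
        have h := abs_inv_sq_sub_inv_sq_le hd (hy t ht) (hz t ht)
        rw [show y - t - (z - t) = y - z by ring] at h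
        calc |F t / (y - t) ^ 2 - F t / (z - t) ^ 2|
            = |F t| * |1 / (y - t) ^ 2 - 1 / (z - t) ^ 2| := by rw [← abs_mul]; congr 1; ring
          _ ≤ |F t| * (|y - z| / d * (1 / (y - t) ^ 2 + 1 / (z - t) ^ 2)) := by gcongr
          _ = _ := by ring
    _ = |y - z| / d * ((∫ t in S, |F t| / (y - t) ^ 2) + ∫ t in S, |F t| / (z - t) ^ 2) := by
        rw [integral_const_mul, integral_add hyi hzi]
    _ ≤ |y - z| / d * (M + M) := by gcongr
    _ = _ := by ring

/-- Replacing the Poisson kernel by its first-order Taylor term in the height. -/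
theorem abs_setIntegral_halfPlanePoisson_sub_le {F : ℝ → ℝ} (hF : Measurable F) {S : Set ℝ}
    (hS : MeasurableSet S) {d M y η : ℝ} (hd : 0 < d) (hη : 0 < η)
    (hy : ∀ t ∈ S, d ≤ |y - t|)
    (hyi : IntegrableOn (fun t => |F t| / (y - t) ^ 2) S)
    (hyM : ∫ t in S, |F t| / (y - t) ^ 2 ≤ M)
    (hPi : IntegrableOn (fun t => halfPlanePoisson y η t * F t) S) :
    |(∫ t in S, halfPlanePoisson y η t * F t) - η / Real.pi * ∫ t in S, F t / (y - t) ^ 2| ≤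
      η ^ 3 / d ^ 2 * M := by
  have hπ := Real.pi_gt_three
  have hFi := IntegrableOn.of_abs_div_sq hF hyi
  rw [← integral_const_mul, ← integral_sub hPi (hFi.const_mul _)]
  calc |∫ t in S, (halfPlanePoisson y η t * F t - η / Real.pi * (F t / (y - t) ^ 2))|
      ≤ ∫ t in S, |halfPlanePoisson y η t * F t - η / Real.pi * (F t / (y - t) ^ 2)| :=
        abs_integral_le_integral_abs
    _ ≤ ∫ t in S, η ^ 3 / d ^ 2 * (|F t| / (y - t) ^ 2) := by
        refine setIntegral_mono_on (hPi.sub (hFi.const_mul _)).abs (hyi.const_mul _) hS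
          fun t ht => ?_
        have h0 : d ^ 2 ≤ (y - t) ^ 2 := by
          rw [← sq_abs (y - t)]; have := hy t ht; gcongr
        have h1 : 0 < (y - t) ^ 2 := lt_of_lt_of_le (by positivity) h0
        -- The Taylor remainder is exact: the difference of the kernels is `-η³ / (π ((y - t)² + η²)
        -- (y - t)²)`.
        have h2 : halfPlanePoisson y η t * F t - η / Real.pi * (F t / (y - t) ^ 2) =
            -(η ^ 3 / (Real.pi * ((y - t) ^ 2 + η ^ 2)) * (F t / (y - t) ^ 2)) := by
          have h3 : y - t ≠ 0 := fun h => by simp [h] at h1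
          rw [halfPlanePoisson]
          field_simp
          ring
        rw [h2, abs_neg, abs_mul, abs_of_nonneg (by positivity), abs_div,
          abs_of_pos h1]
        gcongr
        nlinarith [sq_nonneg η]
    _ = η ^ 3 / d ^ 2 * ∫ t in S, |F t| / (y - t) ^ 2 := integral_const_mul ..
    _ ≤ _ := by gcongr

/-! ### Two-sided bounds for the equilibrium constant. -/

theorem one_le_log_natCast {n : ℕ} (hn : 3 ≤ n) : 1 ≤ Real.log n := by
  have h3 : (3 : ℝ) ≤ n := by exact_mod_cast hn
  rw [Real.le_log_iff_exp_le (by linarith)]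
  linarith [Real.exp_one_lt_d9]

theorem log_div_natCast_le_one (n : ℕ) : Real.log n / n ≤ 1 :=
  div_le_one_of_le₀ (Real.log_le_self n.cast_nonneg) n.cast_nonneg

theorem log_div_natCast_pos {n : ℕ} (hn : 3 ≤ n) : 0 < Real.log n / n := by
  have := one_le_log_natCast hn
  have : (0 : ℝ) < n := by exact_mod_cast (by lia : 0 < n)
  positivity

theorem inv_natCast_le_log_div {n : ℕ} (hn : 3 ≤ n) : 1 / (n : ℝ) ≤ Real.log n / n := by
  have := one_le_log_natCast hn
  gcongr

theorem ae_notMem_range {n : ℕ} (x : Fin n → ℝ) : ∀ᵐ t : ℝ, t ∉ Set.range x :=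
  (Set.finite_range x).countable.ae_notMem volume

theorem neg_log_le_nodePotential {n : ℕ} {x : Fin n → ℝ} {t r : ℝ} (hr : 1 ≤ r)
    (h : ∀ i, 0 < t - x i ∧ t - x i ≤ r) : -Real.log r ≤ nodePotential x t 0 := by
  rw [nodePotential_zero, neg_le_neg_iff]
  exact inv_natCast_mul_sum_const_le (Real.log_nonneg hr) fun i =>
    Real.log_le_log (h i).1 (h i).2

theorem nodePotential_le_neg_log {n : ℕ} (hn : 0 < n) {x : Fin n → ℝ} {t r : ℝ} (hr : 0 < r)
    (h : ∀ i, r ≤ t - x i) : nodePotential x t 0 ≤ -Real.log r := by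
  have hn' : (0 : ℝ) < n := by exact_mod_cast hn
  rw [nodePotential_zero, neg_le_neg_iff]
  calc Real.log r = (n : ℝ)⁻¹ * ∑ i : Fin n, Real.log r := by simp; field_simp
    _ ≤ _ := by gcongr with i; exact h i

/-- Test the upper bound at `t = 2`, whose distance to every node lies in `[1, 3]`; there the term
`log (1 / δ)` is nonpositive. -/
theorem neg_log_three_le_of_bound {n : ℕ} (hn : 0 < n) {x : Fin n → ℝ}
    (hx1 : ∀ i, x i ∈ Set.Icc (-1 : ℝ) 1) {α : ℝ}
    (h : ∀ t, t ∉ Set.range x →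
      nodePotential x t 0 ≤ α + Real.log (1 / nodeDistance x t) / n) : -Real.log 3 ≤ α := by
  have h2 : ∀ i, 1 ≤ 2 - x i ∧ 2 - x i ≤ 3 := fun i =>
    ⟨by linarith [(hx1 i).2], by linarith [(hx1 i).1]⟩
  have hr : (2 : ℝ) ∉ Set.range x := by
    rintro ⟨i, hi⟩
    linarith [(h2 i).1]
  have h3 := neg_log_le_nodePotential (x := x) (t := 2) (r := 3) (by norm_num)
    fun i => ⟨by linarith [(h2 i).1], (h2 i).2⟩
  have h4 := h 2 hr
  have h5 : Real.log (1 / nodeDistance x 2) / n ≤ 0 := by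
    obtain ⟨i, hi⟩ := exists_nodeDistance_eq hn x 2
    refine div_nonpos_of_nonpos_of_nonneg (Real.log_nonpos ?_ ?_) n.cast_nonneg
    · rw [hi]; positivity
    · rw [hi]
      have := (h2 i).1.trans (le_abs_self _)
      exact div_le_one_of_le₀ this (abs_nonneg _)
  linarith

theorem setIntegral_nodePotential_le {n : ℕ} {x : Fin n → ℝ}
    (hx1 : ∀ i, x i ∈ Set.Icc (-1 : ℝ) 1) {I : Set ℝ} (hIm : MeasurableSet I)
    (hI1 : I ⊆ Set.Icc (-1) 1) :
    IntegrableOn (fun t => nodePotential x t 0) I ∧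
      ∫ t in I, nodePotential x t 0 ≤ 5 * ∫ v, weightedLog v := by
  have hmaj : Integrable fun t => 5 * ((n : ℝ)⁻¹ * ∑ i, weightedLog (t - x i)) :=
    ((integrable_finsetSum _ fun i _ => integrable_weightedLog.comp_sub_right (x i)).const_mul
      _).const_mul _
  have hb : ∀ t ∈ I, |nodePotential x t 0| ≤ 5 * ((n : ℝ)⁻¹ * ∑ i, weightedLog (t - x i)) := by
    intro t ht
    refine (abs_nodePotential_zero_le x t).trans ?_
    rw [mul_left_comm (5 : ℝ), Finset.mul_sum Finset.univ _ (5 : ℝ)]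
    gcongr with i
    have h1 := hI1 ht
    have h2 := hx1 i
    have h3 : (t - x i) ^ 2 ≤ 4 := by
      have : |t - x i| ≤ 2 := by
        rw [abs_le]; constructor <;> linarith [h1.1, h1.2, h2.1, h2.2]
      rw [← sq_abs]; nlinarith [abs_nonneg (t - x i)]
    rw [weightedLog, mul_div_assoc', le_div_iff₀ (by positivity)]
    nlinarith [abs_nonneg (Real.log (t - x i))]
  have hint : IntegrableOn (fun t => nodePotential x t 0) I := by
    refine hmaj.integrableOn.mono' (measurable_nodePotential_zero x).aestronglyMeasurable ?_
    filter_upwards [ae_restrict_mem hIm] with t ht using hb t ht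
  refine ⟨hint, ?_⟩
  calc ∫ t in I, nodePotential x t 0
      ≤ ∫ t in I, 5 * ((n : ℝ)⁻¹ * ∑ i, weightedLog (t - x i)) :=
        setIntegral_mono_on hint hmaj.integrableOn hIm fun t ht => (le_abs_self _).trans (hb t ht)
    _ ≤ ∫ t, 5 * ((n : ℝ)⁻¹ * ∑ i, weightedLog (t - x i)) :=
        setIntegral_le_integral hmaj (ae_of_all _ fun t => by
          have : 0 ≤ ∑ i, weightedLog (t - x i) :=
            Finset.sum_nonneg fun i _ => weightedLog_nonneg _
          simp only [Pi.zero_apply]; positivity)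
    _ ≤ _ := by
        rw [integral_const_mul, integral_const_mul,
          integral_finsetSum _ fun i _ => integrable_weightedLog.comp_sub_right (x i)]
        gcongr
        refine inv_natCast_mul_sum_const_le (integral_nonneg weightedLog_nonneg) fun i => ?_
        rw [integral_sub_right_eq_self (μ := volume) weightedLog (x i)]

/-- Average over `I`: the mean of the potential is bounded because the logarithm is locally
integrable. -/
theorem equilibrium_constant_le {n : ℕ} {x : Fin n → ℝ}
    (hx1 : ∀ i, x i ∈ Set.Icc (-1 : ℝ) 1) {I : Set ℝ} (hIm : MeasurableSet I)
    (hI1 : I ⊆ Set.Icc (-1) 1) (hIpos : 0 < volume.real I) {β : ℝ}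
    (h : ∀ t ∈ I, t ∉ Set.range x → β ≤ nodePotential x t 0) :
    β ≤ 5 * (∫ v, weightedLog v) / volume.real I := by
  obtain ⟨hint, hle⟩ := setIntegral_nodePotential_le hx1 hIm hI1
  have hfin : volume I ≠ ⊤ :=
    ((measure_mono hI1).trans_lt measure_Icc_lt_top).ne
  rw [le_div_iff₀ hIpos]
  calc β * volume.real I = ∫ t in I, β := by simp [mul_comm]
    _ ≤ ∫ t in I, nodePotential x t 0 := by
        refine setIntegral_mono_on_ae (integrableOn_const hfin) hint hIm ?_
        filter_upwards [ae_notMem_range x] with t ht hI using h t hI ht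
    _ ≤ _ := hle

/-! ### Expansion of the potential above the interval, and the density. -/

theorem halfPlanePoisson_nonneg (y : ℝ) {η : ℝ} (hη : 0 < η) (t : ℝ) :
    0 ≤ halfPlanePoisson y η t := by
  have := Real.pi_pos
  unfold halfPlanePoisson; positivity

theorem abs_halfPlanePoisson_le (y : ℝ) {η : ℝ} (hη : 0 < η) (t : ℝ) :
    |halfPlanePoisson y η t| ≤ 1 / η := by
  rw [abs_of_nonneg (halfPlanePoisson_nonneg y hη t), halfPlanePoisson]
  have := Real.pi_gt_three
  rw [div_le_div_iff₀ (by positivity) hη]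
  nlinarith [sq_nonneg (y - t), sq_nonneg η]

theorem integrable_halfPlanePoisson_mul_sub_const {n : ℕ} (x : Fin n → ℝ) (α y : ℝ) {η : ℝ}
    (hη : 0 < η) :
    Integrable fun t => halfPlanePoisson y η t * (nodePotential x t 0 - α) := by
  simp only [mul_sub]
  exact (integrable_halfPlanePoisson_mul_nodePotential x y hη).sub
    ((integrable_halfPlanePoisson y hη).mul_const α)

/-- On `I` the boundary values are `α` up to `c` and the averaged peaks. The restriction on `η`
makes the kernel at most `n`, as `integral_mul_nodeError_le` needs. -/
theorem abs_setIntegral_halfPlanePoisson_le {n : ℕ} (hn : 3 ≤ n) {x : Fin n → ℝ} {I : Set ℝ}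
    (hIm : MeasurableSet I) {α c y η : ℝ} (hc : 0 ≤ c) (hη : Real.log n / n ≤ η)
    (hup : ∀ t, t ∉ Set.range x → nodePotential x t 0 ≤ α + nodeError x t)
    (hlow : ∀ t ∈ I, t ∉ Set.range x → α - c ≤ nodePotential x t 0) :
    |∫ t in I, halfPlanePoisson y η t * (nodePotential x t 0 - α)| ≤
      2 * (4 + 2 * ∫ v, spike v) * (Real.log n / n) + c := by
  have hη0 : 0 < η := (log_div_natCast_pos hn).trans_le hη
  have hn' : (0 : ℝ) < n := by exact_mod_cast (by lia : 0 < n)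
  have hP := integrable_halfPlanePoisson y hη0
  have hPe := integrable_mul_nodeError x hP (abs_halfPlanePoisson_le y hη0)
  have hmaj : Integrable fun t => halfPlanePoisson y η t * nodeError x t +
    halfPlanePoisson y η t * c := hPe.add (hP.mul_const c)
  have hH : 0 ≤ ∫ v, spike v := integral_nonneg spike_nonneg
  calc |∫ t in I, halfPlanePoisson y η t * (nodePotential x t 0 - α)|
      ≤ ∫ t in I, |halfPlanePoisson y η t * (nodePotential x t 0 - α)| :=
        abs_integral_le_integral_abs
    _ ≤ ∫ t in I, (halfPlanePoisson y η t * nodeError x t + halfPlanePoisson y η t * c) := by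
        refine setIntegral_mono_on_ae
          (integrable_halfPlanePoisson_mul_sub_const x α y hη0).abs.integrableOn
          hmaj.integrableOn hIm ?_
        filter_upwards [ae_notMem_range x] with t ht hI
        have hP0 := halfPlanePoisson_nonneg y hη0 t
        rw [abs_mul, abs_of_nonneg hP0, ← mul_add]
        gcongr
        have h1 := hup t ht
        have h2 := hlow t hI ht
        have h3 := nodeError_nonneg x t
        rw [abs_le]; constructor <;> linarith
    _ ≤ ∫ t, (halfPlanePoisson y η t * nodeError x t + halfPlanePoisson y η t * c) :=
        setIntegral_le_integral hmaj (ae_of_all _ fun t => by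
          have := halfPlanePoisson_nonneg y hη0 t
          have := nodeError_nonneg x t
          simp only [Pi.zero_apply]; positivity)
    _ = (∫ t, halfPlanePoisson y η t * nodeError x t) + c := by
        rw [integral_add hPe (hP.mul_const c), integral_mul_const,
          integral_halfPlanePoisson y hη0, one_mul]
    _ ≤ (4 + 2 * ∫ v, spike v) * (Real.log n / n) * (|∫ t, halfPlanePoisson y η t|
          + (1 / η) / n) + c := by
        gcongr
        exact integral_mul_nodeError_le hn x hP (abs_halfPlanePoisson_le y hη0)
    _ ≤ (4 + 2 * ∫ v, spike v) * (Real.log n / n) * (1 + 1) + c := by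
        have := log_div_natCast_pos hn
        rw [integral_halfPlanePoisson y hη0, abs_one]
        gcongr
        rw [div_div, div_le_one (by positivity)]
        have h1 := inv_natCast_le_log_div hn
        have h2 : 1 / (n : ℝ) ≤ η := h1.trans hη
        rwa [div_le_iff₀ hn'] at h2
    _ = _ := by ring

/-- The candidate density: minus `π⁻¹` times the normal derivative of the potential generated by
its values on `S`. -/
noncomputable def potentialDensity {n : ℕ} (x : Fin n → ℝ) (α : ℝ) (S : Set ℝ) (y : ℝ) : ℝ :=
  -(1 / Real.pi ^ 2 * ∫ t in S, (nodePotential x t 0 - α) / (y - t) ^ 2)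

theorem abs_nodePotential_sub_le {n : ℕ} (hn : 3 ≤ n) {x : Fin n → ℝ}
    (hx1 : ∀ i, x i ∈ Set.Icc (-1 : ℝ) 1) {I : Set ℝ}
    (hIm : MeasurableSet I) {α c d y η : ℝ} (hc : 0 ≤ c) (hη : Real.log n / n ≤ η)
    (hup : ∀ t, t ∉ Set.range x → nodePotential x t 0 ≤ α + nodeError x t)
    (hlow : ∀ t ∈ I, t ∉ Set.range x → α - c ≤ nodePotential x t 0)
    (hd : 0 < d) (hy : y ∈ Set.Icc (-1 : ℝ) 1) (hdI : ∀ t ∈ Iᶜ, d ≤ |y - t|) :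
    |nodePotential x y η - (α - Real.pi * η * potentialDensity x α Iᶜ y)| ≤
      2 * (4 + 2 * ∫ v, spike v) * (Real.log n / n) + c +
        η ^ 3 / d ^ 2 * ((9 / d ^ 2 + 2) * ((∫ v, weightedLog v) + |α| * Real.pi)) := by
  have hη0 : 0 < η := (log_div_natCast_pos hn).trans_le hη
  have hint := integrable_halfPlanePoisson_mul_sub_const x α y hη0
  have h1 : nodePotential x y η - α =
      (∫ t in I, halfPlanePoisson y η t * (nodePotential x t 0 - α)) +
      ∫ t in Iᶜ, halfPlanePoisson y η t * (nodePotential x t 0 - α) := by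
    rw [integral_add_compl hIm hint]
    simp only [mul_sub]
    rw [integral_sub (integrable_halfPlanePoisson_mul_nodePotential x y hη0)
      ((integrable_halfPlanePoisson y hη0).mul_const α), integral_mul_const,
      integral_halfPlanePoisson y hη0, integral_halfPlanePoisson_mul_nodePotential x y hη0, one_mul]
  have h2 := abs_setIntegral_halfPlanePoisson_le hn hIm (y := y) hc hη hup hlow
  have h3 := abs_setIntegral_halfPlanePoisson_sub_le
    ((measurable_nodePotential_zero x).sub_const α) hIm.compl hd hη0 hdI
    (integrableOn_potential_div_sq hx1 α hIm.compl hd hy hdI)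
    (setIntegral_potential_div_sq_le hx1 α hIm.compl hd hy hdI) hint.integrableOn
  have h4 : nodePotential x y η - (α - Real.pi * η * potentialDensity x α Iᶜ y) =
      (∫ t in I, halfPlanePoisson y η t * (nodePotential x t 0 - α)) +
      ((∫ t in Iᶜ, halfPlanePoisson y η t * (nodePotential x t 0 - α)) -
        η / Real.pi * ∫ t in Iᶜ, (nodePotential x t 0 - α) / (y - t) ^ 2) := by
    have hπ := Real.pi_ne_zero
    have h5 : Real.pi * η * potentialDensity x α Iᶜ y =
        -(η / Real.pi * ∫ t in Iᶜ, (nodePotential x t 0 - α) / (y - t) ^ 2) := by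
      rw [potentialDensity]; field_simp
    rw [h5]
    linarith
  rw [h4]
  exact (abs_add_le _ _).trans (add_le_add h2 h3)

theorem abs_potentialDensity_le {n : ℕ} {x : Fin n → ℝ}
    (hx1 : ∀ i, x i ∈ Set.Icc (-1 : ℝ) 1) {S : Set ℝ}
    (hS : MeasurableSet S) (α : ℝ) {d y : ℝ}
    (hd : 0 < d) (hy : y ∈ Set.Icc (-1 : ℝ) 1) (hdS : ∀ t ∈ S, d ≤ |y - t|) :
    |potentialDensity x α S y| ≤ (9 / d ^ 2 + 2) * ((∫ v, weightedLog v) + |α| * Real.pi) := by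
  have h1 := setIntegral_potential_div_sq_le hx1 α hS hd hy hdS
  have hπ := Real.pi_gt_three
  have h2 : |∫ t in S, (nodePotential x t 0 - α) / (y - t) ^ 2| ≤
      ∫ t in S, |nodePotential x t 0 - α| / (y - t) ^ 2 := by
    refine abs_integral_le_integral_abs.trans (le_of_eq ?_)
    congr 1 with t
    rw [abs_div, abs_of_nonneg (sq_nonneg (y - t))]
  rw [potentialDensity, abs_neg, abs_mul, abs_of_pos (by positivity), one_div_mul_eq_div]
  refine (div_le_self (abs_nonneg _) ?_).trans (h2.trans h1)
  nlinarith

theorem abs_potentialDensity_sub_le {n : ℕ} {x : Fin n → ℝ}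
    (hx1 : ∀ i, x i ∈ Set.Icc (-1 : ℝ) 1) {S : Set ℝ}
    (hS : MeasurableSet S) (α : ℝ) {d y z : ℝ}
    (hd : 0 < d) (hy : y ∈ Set.Icc (-1 : ℝ) 1) (hdy : ∀ t ∈ S, d ≤ |y - t|)
    (hz : z ∈ Set.Icc (-1 : ℝ) 1) (hdz : ∀ t ∈ S, d ≤ |z - t|) :
    |potentialDensity x α S y - potentialDensity x α S z| ≤
      2 * ((9 / d ^ 2 + 2) * ((∫ v, weightedLog v) + |α| * Real.pi)) / d * |y - z| := by
  have hπ := Real.pi_gt_three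
  have h := abs_setIntegral_div_sq_sub_le ((measurable_nodePotential_zero x).sub_const α) hS hd
    hdy hdz (integrableOn_potential_div_sq hx1 α hS hd hy hdy)
    (integrableOn_potential_div_sq hx1 α hS hd hz hdz)
    (setIntegral_potential_div_sq_le hx1 α hS hd hy hdy)
    (setIntegral_potential_div_sq_le hx1 α hS hd hz hdz)
  rw [potentialDensity, potentialDensity, ← neg_sub', abs_neg, ← mul_sub, abs_mul,
    abs_of_pos (by positivity), one_div_mul_eq_div]
  refine (div_le_self (abs_nonneg _) ?_).trans h
  nlinarith

/-- Everywhere `U - α` is at most `nodeError`, which integrates to `O(log n / n)`. On `(T, T + 1]`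
all nodes are at distance at least `T - 1`, so `U - α ≤ -1` there; this fixed interval supplies the
main term. -/
theorem le_potentialDensity {n : ℕ} (hn : 3 ≤ n) {x : Fin n → ℝ}
    (hx1 : ∀ i, x i ∈ Set.Icc (-1 : ℝ) 1) {S : Set ℝ} (hS : MeasurableSet S)
    (hS1 : ∀ t, 1 < t → t ∈ S) {α T d y : ℝ} (hT : 1 < T) (hTα : -Real.log (T - 1) ≤ α - 1)
    (hup : ∀ t, t ∉ Set.range x → nodePotential x t 0 ≤ α + nodeError x t)
    (hd : 0 < d) (hy : y ∈ Set.Icc (-1 : ℝ) 1) (hdS : ∀ t ∈ S, d ≤ |y - t|) :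
    1 / (Real.pi ^ 2 * (T + 2) ^ 2) - (4 + 2 * ∫ v, spike v) *
      ((9 / d ^ 2 + 2) * Real.pi + 1 / d ^ 2) * (Real.log n / n) ≤ potentialDensity x α S y := by
  have hπ := Real.pi_gt_three
  have hn0 : 0 < n := by lia
  have hn' : (1 : ℝ) ≤ n := by exact_mod_cast hn0
  have hH : 0 ≤ ∫ v, spike v := integral_nonneg spike_nonneg
  have hκ := log_div_natCast_pos hn
  set w : ℝ → ℝ := S.indicator fun t => 1 / (y - t) ^ 2 with hw
  have hw0 : ∀ t, 0 ≤ w t := fun t => Set.indicator_nonneg (fun t _ => by positivity) t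
  have hwd : ∀ t, |w t| ≤ 1 / d ^ 2 := by
    intro t
    rw [abs_of_nonneg (hw0 t)]
    by_cases ht : t ∈ S
    · have := hdS t ht
      rw [hw, Set.indicator_of_mem ht, ← sq_abs (y - t)]
      gcongr
    · rw [hw, Set.indicator_of_notMem ht]
      positivity
  have hwle : ∀ t, w t ≤ (9 / d ^ 2 + 2) * (1 + t ^ 2)⁻¹ := by
    intro t
    by_cases ht : t ∈ S
    · have := inv_sq_le_inv_one_add_sq hd hy (s := 0) (by constructor <;> norm_num) (hdS t ht)
      rw [hw, Set.indicator_of_mem ht]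
      simpa using this
    · rw [hw, Set.indicator_of_notMem ht]
      positivity
  have hwm : Measurable w := Measurable.indicator (by fun_prop) hS
  have hwi : Integrable w := by
    refine (integrable_inv_one_add_sq.const_mul (9 / d ^ 2 + 2)).mono'
      hwm.aestronglyMeasurable (ae_of_all _ fun t => ?_)
    rw [Real.norm_eq_abs, abs_of_nonneg (hw0 t)]
    exact hwle t
  have hwint : |∫ t, w t| ≤ (9 / d ^ 2 + 2) * Real.pi := by
    rw [abs_of_nonneg (integral_nonneg hw0), ← integral_univ_inv_one_add_sq,
      ← integral_const_mul]
    exact integral_mono hwi (integrable_inv_one_add_sq.const_mul _) hwle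
  have he := integral_mul_nodeError_le hn x hwi hwd
  have hei := integrable_mul_nodeError x hwi hwd
  have hbi : Integrable ((Set.Ioc T (T + 1)).indicator fun _ => 1 / (T + 2) ^ 2) :=
    (integrable_indicator_iff measurableSet_Ioc).2 (integrableOn_const measure_Ioc_lt_top.ne)
  have hF : ∫ t in S, (nodePotential x t 0 - α) / (y - t) ^ 2 ≤
      (∫ t, w t * nodeError x t) - 1 / (T + 2) ^ 2 := by
    calc ∫ t in S, (nodePotential x t 0 - α) / (y - t) ^ 2
        = ∫ t, S.indicator (fun t => (nodePotential x t 0 - α) / (y - t) ^ 2) t :=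
          (integral_indicator hS).symm
      _ ≤ ∫ t, (w t * nodeError x t -
            (Set.Ioc T (T + 1)).indicator (fun _ => 1 / (T + 2) ^ 2) t) := by
          refine integral_mono_ae ?_ (hei.sub hbi) ?_
          · exact (integrable_indicator_iff hS).2 (IntegrableOn.of_abs_div_sq
              ((measurable_nodePotential_zero x).sub_const α)
              (integrableOn_potential_div_sq hx1 α hS hd hy hdS))
          · filter_upwards [ae_notMem_range x] with t ht
            by_cases htS : t ∈ S
            · rw [Set.indicator_of_mem htS, hw, Set.indicator_of_mem htS]
              by_cases htT : t ∈ Set.Ioc T (T + 1)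
              · rw [Set.indicator_of_mem htT]
                have h1 : nodePotential x t 0 - α ≤ -1 := by
                  have := nodePotential_le_neg_log hn0 (x := x) (t := t) (r := T - 1)
                    (by linarith) fun i => by linarith [(hx1 i).2, htT.1]
                  linarith
                have h2 : 0 < t - y := by linarith [hy.2, htT.1]
                have h3 : 1 / (T + 2) ^ 2 ≤ 1 / (y - t) ^ 2 := by
                  rw [← neg_sub t y, neg_sq]
                  gcongr
                  linarith [hy.1, htT.2]
                have h4 := nodeError_nonneg x t
                have h5 : 0 ≤ 1 / (y - t) ^ 2 := by positivity
                rw [div_eq_mul_one_div]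
                nlinarith [mul_nonneg h5 h4]
              · rw [Set.indicator_of_notMem htT, sub_zero, div_eq_mul_one_div, mul_comm]
                have := hup t ht
                gcongr
                linarith
            · have htT : t ∉ Set.Ioc T (T + 1) := fun h => htS (hS1 t (hT.trans h.1))
              rw [Set.indicator_of_notMem htS, hw, Set.indicator_of_notMem htS,
                Set.indicator_of_notMem htT]
              simp
      _ = _ := by
          rw [integral_sub hei hbi, integral_indicator measurableSet_Ioc]
          simp
  set E := (4 + 2 * ∫ v, spike v) * ((9 / d ^ 2 + 2) * Real.pi + 1 / d ^ 2) *
    (Real.log n / n) with hE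
  have hE0 : 0 ≤ E := by positivity
  have he2 : ∫ t, w t * nodeError x t ≤ E := by
    refine he.trans ?_
    have h8 : 1 / d ^ 2 / (n : ℝ) ≤ 1 / d ^ 2 := div_le_self (by positivity) hn'
    rw [hE, mul_right_comm]
    gcongr
  have h6 : ∫ t in S, (nodePotential x t 0 - α) / (y - t) ^ 2 ≤ E - 1 / (T + 2) ^ 2 := by
    linarith
  have h7 : E / Real.pi ^ 2 ≤ E := div_le_self hE0 (by nlinarith)
  calc 1 / (Real.pi ^ 2 * (T + 2) ^ 2) - E
      ≤ 1 / (Real.pi ^ 2 * (T + 2) ^ 2) - E / Real.pi ^ 2 := by linarith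
    _ = -(1 / Real.pi ^ 2 * (E - 1 / (T + 2) ^ 2)) := by field_simp; ring
    _ ≤ _ := by unfold potentialDensity; gcongr

/-! ### Local mass bounds through Cauchy bumps. -/

theorem div_one_add_le_log {v : ℝ} (hv : 0 ≤ v) : v / (1 + v) ≤ Real.log (1 + v) := by
  have h := Real.one_sub_inv_le_log_of_pos (by linarith : 0 < 1 + v)
  have h2 : v / (1 + v) = 1 - (1 + v)⁻¹ := by field_simp; ring
  linarith

/-- The bump `R² / (r² + R²)` of width `R`. -/
noncomputable def cauchyBump (r R : ℝ) : ℝ := R ^ 2 / (r ^ 2 + R ^ 2)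

theorem cauchyBump_nonneg (r R : ℝ) : 0 ≤ cauchyBump r R := by unfold cauchyBump; positivity

theorem cauchyBump_le_one (r R : ℝ) : cauchyBump r R ≤ 1 :=
  div_le_one_of_le₀ (by nlinarith [sq_nonneg r]) (by positivity)

theorem le_cauchyBump {r R c S : ℝ} (hR : 0 < R) (hc : 0 < c) (hS : 0 < S)
    (h1 : r ^ 2 ≤ c * S ^ 2) (h2 : S ≤ R) : 1 / (c + 1) ≤ cauchyBump r R := by
  rw [cauchyBump, div_le_div_iff₀ (by positivity) (by positivity)]
  have : S ^ 2 ≤ R ^ 2 := by gcongr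
  nlinarith

theorem nodePotential_sub_eq {n : ℕ} (x : Fin n → ℝ) (y R S : ℝ) :
    nodePotential x y R - nodePotential x y S = (n : ℝ)⁻¹ * ∑ i,
      1 / 2 * (Real.log ((y - x i) ^ 2 + S ^ 2) - Real.log ((y - x i) ^ 2 + R ^ 2)) := by
  simp only [nodePotential, mul_sub, Finset.sum_sub_distrib]
  ring

/-- The difference of logarithms is `log (1 + v)` with `v = 3R² / (u² + R²)`, and `v / (1 + v) = 3R²
/ (u² + 4R²)`. -/
theorem cauchyBump_le_log_sub (u : ℝ) {R : ℝ} (hR : 0 < R) :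
    3 / 4 * cauchyBump u R ≤ Real.log (u ^ 2 + (2 * R) ^ 2) - Real.log (u ^ 2 + R ^ 2) := by
  rw [← Real.log_div (by positivity) (by positivity)]
  have h1 : (u ^ 2 + (2 * R) ^ 2) / (u ^ 2 + R ^ 2) = 1 + 3 * R ^ 2 / (u ^ 2 + R ^ 2) := by
    field_simp; ring
  rw [h1]
  refine le_trans ?_ (div_one_add_le_log (by positivity))
  have h2 : 3 * R ^ 2 / (u ^ 2 + R ^ 2) / (1 + 3 * R ^ 2 / (u ^ 2 + R ^ 2)) =
      3 * R ^ 2 / (u ^ 2 + 4 * R ^ 2) := by field_simp; ring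
  rw [h2, cauchyBump, div_mul_div_comm, div_le_div_iff₀ (by positivity) (by positivity)]
  nlinarith [mul_nonneg (sq_nonneg R) (sq_nonneg u)]

theorem log_sub_nonneg (u R : ℝ) (hR : 0 < R) :
    0 ≤ Real.log (u ^ 2 + (2 * R) ^ 2) - Real.log (u ^ 2 + R ^ 2) := by
  have := cauchyBump_le_log_sub u hR
  have := cauchyBump_nonneg u R
  linarith

theorem log_sub_le (u : ℝ) {R : ℝ} (hR : 0 < R) :
    Real.log (u ^ 2 + (2 * R) ^ 2) - Real.log (u ^ 2 + R ^ 2) ≤ 3 * R ^ 2 / (u ^ 2 + R ^ 2) := by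
  rw [← Real.log_div (by positivity) (by positivity)]
  have h1 : (u ^ 2 + (2 * R) ^ 2) / (u ^ 2 + R ^ 2) = 1 + 3 * R ^ 2 / (u ^ 2 + R ^ 2) := by
    field_simp; ring
  have := Real.log_le_sub_one_of_pos
    (by positivity : 0 < (u ^ 2 + (2 * R) ^ 2) / (u ^ 2 + R ^ 2))
  linarith

/-- Subtracting the expansions at heights `R` and `2R` cancels `α` and leaves `O(R)`, while the same
difference dominates the bump average. For `R ≥ 1` the bound is trivial, since bumps are at most
`1`. -/
theorem inv_mul_sum_cauchyBump_le {n : ℕ} {x : Fin n → ℝ} {α κ D r y R : ℝ} (hκ : 0 < κ)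
    (hD : 1 ≤ D) (hr : r ≤ D)
    (h : ∀ η, κ ≤ η → |nodePotential x y η - (α - Real.pi * η * r)| ≤ D * (κ + η ^ 3))
    (hR : κ ≤ R) : (n : ℝ)⁻¹ * ∑ i, cauchyBump (y - x i) R ≤ 40 * D * R := by
  have hR0 : 0 < R := hκ.trans_le hR
  rcases le_or_gt 1 R with h1 | h1
  · refine (inv_natCast_mul_sum_const_le zero_le_one fun i => cauchyBump_le_one _ _).trans ?_
    nlinarith
  · have e1 := (abs_le.1 (h R hR)).2
    have e2 := (abs_le.1 (h (2 * R) (by linarith))).1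
    have e3 : 3 / 8 * ((n : ℝ)⁻¹ * ∑ i, cauchyBump (y - x i) R) ≤
        nodePotential x y R - nodePotential x y (2 * R) := by
      rw [nodePotential_sub_eq, mul_left_comm (3 / 8 : ℝ), Finset.mul_sum Finset.univ _ (3 / 8 : ℝ)]
      refine mul_le_mul_of_nonneg_left (Finset.sum_le_sum fun i _ => ?_) (by positivity)
      have := cauchyBump_le_log_sub (y - x i) hR0
      linarith
    have e4 : R ^ 3 ≤ R := by nlinarith [mul_pos hR0 hR0]
    have e5 : Real.pi * R * r ≤ 4 * R * D := by
      have := Real.pi_pos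
      have := Real.pi_le_four
      calc Real.pi * R * r ≤ Real.pi * R * D := by gcongr
        _ ≤ _ := by gcongr
    have e6 : D * (κ + R ^ 3) + D * (κ + (2 * R) ^ 3) ≤ 11 * D * R := by
      have : κ + R ^ 3 + (κ + (2 * R) ^ 3) ≤ 11 * R := by nlinarith
      nlinarith
    nlinarith

/-! ### Smoothed indicator functions. -/

/-- Antiderivative of the smoothing kernel `(log (u² + 4η²) - log (u² + η²)) / (2πη)`. -/
noncomputable def smoothedStep (η u : ℝ) : ℝ :=
  (2 * Real.pi * η)⁻¹ * (u * (Real.log (u ^ 2 + (2 * η) ^ 2) - Real.log (u ^ 2 + η ^ 2))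
    + 2 * (2 * η) * Real.arctan (u / (2 * η)) - 2 * η * Real.arctan (u / η))

theorem smoothedStep_neg (η u : ℝ) : smoothedStep η (-u) = -smoothedStep η u := by
  simp only [smoothedStep, neg_sq, neg_div, Real.arctan_neg]
  ring

theorem hasDerivAt_mul_log_add_arctan {a : ℝ} (ha : 0 < a) (u : ℝ) :
    HasDerivAt (fun u => u * Real.log (u ^ 2 + a ^ 2) + 2 * a * Real.arctan (u / a))
      (Real.log (u ^ 2 + a ^ 2) + 2) u := by
  have h1 : HasDerivAt (fun u : ℝ => u ^ 2 + a ^ 2) (2 * u) u := by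
    simpa using (hasDerivAt_pow 2 u).add_const (a ^ 2)
  have h2 := (hasDerivAt_id u).mul (h1.log (by positivity))
  have h3 := (((hasDerivAt_id u).div_const a).arctan).const_mul (2 * a)
  refine (h2.add h3).congr_deriv ?_
  simp only [id]
  field_simp
  ring

theorem hasDerivAt_smoothedStep {η : ℝ} (hη : 0 < η) (u : ℝ) :
    HasDerivAt (smoothedStep η) ((2 * Real.pi * η)⁻¹ *
      (Real.log (u ^ 2 + (2 * η) ^ 2) - Real.log (u ^ 2 + η ^ 2))) u := by
  have h := ((hasDerivAt_mul_log_add_arctan (by positivity : 0 < 2 * η) u).sub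
    (hasDerivAt_mul_log_add_arctan hη u)).const_mul (2 * Real.pi * η)⁻¹
  refine (h.congr_deriv (by ring)).congr_of_eventuallyEq (Filter.Eventually.of_forall fun v => ?_)
  simp only [smoothedStep, Pi.sub_apply]
  ring

theorem arctan_le_self_of_nonneg {y : ℝ} (hy : 0 ≤ y) : Real.arctan y ≤ y := by
  have h1 : 0 ≤ Real.arctan y := Real.arctan_nonneg.2 hy
  have := Real.le_tan h1 (Real.arctan_lt_pi_div_two y)
  rwa [Real.tan_arctan] at this

/-- Replacing `arctan v` by `π / 2 - arctan (1 / v)` isolates the limit `1 / 2`. By oddness the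
smoothing kernel thus has total mass `1`. -/
theorem abs_half_sub_smoothedStep_le {η u : ℝ} (hη : 0 < η) (hu : 0 < u) :
    |1 / 2 - smoothedStep η u| ≤ 2 * η / u := by
  have hπ := Real.pi_gt_three
  have h1 : Real.arctan (u / (2 * η)) = Real.pi / 2 - Real.arctan (2 * η / u) := by
    rw [← Real.arctan_inv_of_pos (by positivity), inv_div]
  have h2 : Real.arctan (u / η) = Real.pi / 2 - Real.arctan (η / u) := by
    rw [← Real.arctan_inv_of_pos (by positivity), inv_div]
  set Lg := Real.log (u ^ 2 + (2 * η) ^ 2) - Real.log (u ^ 2 + η ^ 2) with hL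
  have h3 : 1 / 2 - smoothedStep η u = (2 * Real.pi * η)⁻¹ *
      (4 * η * Real.arctan (2 * η / u) - 2 * η * Real.arctan (η / u) - u * Lg) := by
    rw [smoothedStep, h1, h2, ← hL]
    field_simp
    ring
  have a1 := arctan_le_self_of_nonneg (by positivity : 0 ≤ 2 * η / u)
  have a2 := arctan_le_self_of_nonneg (by positivity : 0 ≤ η / u)
  have a3 : 0 ≤ Real.arctan (2 * η / u) := Real.arctan_nonneg.2 (by positivity)
  have a4 : 0 ≤ Real.arctan (η / u) := Real.arctan_nonneg.2 (by positivity)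
  have a5 : 0 ≤ Lg := log_sub_nonneg u η hη
  have a6 : u * Lg ≤ 3 * η ^ 2 / u := by
    calc u * Lg ≤ u * (3 * η ^ 2 / (u ^ 2 + η ^ 2)) := by gcongr; exact log_sub_le u hη
      _ ≤ u * (3 * η ^ 2 / u ^ 2) := by gcongr; nlinarith
      _ = _ := by field_simp
  have b : |4 * η * Real.arctan (2 * η / u) - 2 * η * Real.arctan (η / u) - u * Lg| ≤
      8 * η ^ 2 / u := by
    have c1 : 4 * η * Real.arctan (2 * η / u) ≤ 4 * η * (2 * η / u) := by gcongr
    have c2 : 2 * η * Real.arctan (η / u) ≤ 2 * η * (η / u) := by gcongr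
    have c3 : 4 * η * (2 * η / u) = 8 * η ^ 2 / u := by ring
    have c4 : 2 * η * (η / u) + 3 * η ^ 2 / u + 3 * η ^ 2 / u = 8 * η ^ 2 / u := by ring
    have c5 : 0 ≤ 4 * η * Real.arctan (2 * η / u) := by positivity
    have c6 : 0 ≤ 2 * η * Real.arctan (η / u) := by positivity
    have c7 : 0 ≤ u * Lg := by positivity
    have c8 : 0 ≤ 3 * η ^ 2 / u := by positivity
    rw [abs_le]; constructor <;> linarith
  rw [h3, abs_mul, abs_of_pos (by positivity)]
  calc (2 * Real.pi * η)⁻¹ * _ ≤ (2 * Real.pi * η)⁻¹ * (8 * η ^ 2 / u) := by gcongr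
    _ = (4 / Real.pi) * (η / u) := by field_simp; ring
    _ ≤ 2 * (η / u) := by gcongr; rw [div_le_iff₀ (by positivity)]; linarith
    _ = _ := by ring

theorem abs_smoothedStep_le {η : ℝ} (hη : 0 < η) (u : ℝ) : |smoothedStep η u| ≤ 2 := by
  have hπ := Real.pi_gt_three
  have h1 := abs_le.2 ⟨(Real.neg_pi_div_two_lt_arctan (u / (2 * η))).le,
    (Real.arctan_lt_pi_div_two (u / (2 * η))).le⟩
  have h2 := abs_le.2 ⟨(Real.neg_pi_div_two_lt_arctan (u / η)).le,
    (Real.arctan_lt_pi_div_two (u / η)).le⟩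
  have h3 : |u * (Real.log (u ^ 2 + (2 * η) ^ 2) - Real.log (u ^ 2 + η ^ 2))| ≤ 3 * η := by
    rw [abs_mul, abs_of_nonneg (log_sub_nonneg u η hη)]
    calc _ ≤ |u| * (3 * η ^ 2 / (u ^ 2 + η ^ 2)) := by gcongr; exact log_sub_le u hη
      _ ≤ 3 * η := by
        rw [mul_div_assoc', div_le_iff₀ (by positivity), ← sq_abs u]
        nlinarith [sq_nonneg (|u| - η), mul_nonneg hη.le (sq_nonneg (|u| - η)),
          mul_pos hη (mul_pos hη hη), mul_nonneg hη.le (sq_nonneg |u|)]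
  rw [smoothedStep, abs_mul, abs_of_pos (by positivity), inv_mul_le_iff₀ (by positivity)]
  calc _ ≤ 3 * η + 2 * (2 * η) * (Real.pi / 2) + 2 * η * (Real.pi / 2) := by
        refine (abs_sub _ _).trans (add_le_add ((abs_add_le _ _).trans (add_le_add h3 ?_)) ?_)
        · rw [abs_mul, abs_of_pos (by positivity)]; gcongr
        · rw [abs_mul, abs_of_pos (by positivity)]; gcongr
    _ ≤ _ := by nlinarith

theorem abs_smoothedStep_sub_le {η r u v : ℝ} (hη : 0 < η) (hr : 0 < r) (hu : r ≤ u)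
    (huv : u ≤ v) : |smoothedStep η v - smoothedStep η u| ≤ η / r ^ 2 * (v - u) := by
  have hπ := Real.pi_gt_three
  have h := (convex_Ici r).norm_image_sub_le_of_norm_hasDerivWithin_le
    (f := smoothedStep η) (C := η / r ^ 2) (x := u) (y := v)
    (fun w _ => (hasDerivAt_smoothedStep hη w).hasDerivWithinAt) (fun w hw => ?_) hu
    (hu.trans huv)
  · rwa [Real.norm_eq_abs, Real.norm_eq_abs, abs_of_nonneg (sub_nonneg.2 huv)] at h
  · rw [Real.norm_eq_abs, abs_mul, abs_of_pos (by positivity),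
      abs_of_nonneg (log_sub_nonneg w η hη), inv_mul_le_iff₀ (by positivity)]
    have hw' : r ≤ w := hw
    calc _ ≤ 3 * η ^ 2 / (w ^ 2 + η ^ 2) := log_sub_le w hη
      _ ≤ 3 * η ^ 2 / r ^ 2 := by
        gcongr
        nlinarith [sq_nonneg η]
      _ ≤ 2 * Real.pi * η ^ 2 / r ^ 2 := by gcongr; linarith
      _ = _ := by ring

/-- The smoothing error to the left of the interval. -/
theorem abs_smoothedStep_sub_le_of_left {a b s η K W ε : ℝ} (hab : a ≤ b) (hη : 0 < η)
    (hK : 1 ≤ K) (hW : W = K * η) (hε : 0 < ε) (hs : s < a) (haW : W ≤ a - s) :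
    |smoothedStep η (b - s) - smoothedStep η (a - s)| ≤
      20 * (cauchyBump (a - s) W +
        1 / K * cauchyBump ((a + b) / 2 - s) (b - a + ε)) := by
  have hK0 : 0 < K := by linarith
  have hW0 : 0 < W := by rw [hW]; positivity
  set r := a - s with hr
  set L := b - a with hL
  have hr0 : 0 < r := by linarith
  have hL0 : 0 ≤ L := by linarith
  have hb : b - s = r + L := by linarith
  have hm : (a + b) / 2 - s = r + L / 2 := by linarith
  have hc1 := cauchyBump_nonneg r W
  have hc2 := cauchyBump_nonneg (r + L / 2) (L + ε)
  have hηW : η = W / K := by rw [hW]; field_simp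
  rw [hb, hm]
  rcases lt_or_ge r L with h | h
  -- Here `s` is close to the interval relative to its length: both steps are within `2 / K` of `1 /
  -- 2`, and the bump at the midpoint is bounded below.
  · have e1 := abs_half_sub_smoothedStep_le hη hr0
    have e2 := abs_half_sub_smoothedStep_le hη (by linarith : 0 < r + L)
    have e3 : 2 * η / (r + L) ≤ 2 * η / r := by gcongr; linarith
    have e4 : 2 * η / r ≤ 2 * η / W := by gcongr
    have e5 : 2 * η / W = 2 / K := by rw [hW]; field_simp
    have e6 := le_cauchyBump (r := r + L / 2) (R := L + ε) (c := 3) (S := L) (by linarith)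
      (by norm_num) (by linarith) (by nlinarith) (by linarith)
    have e7 : |smoothedStep η (r + L) - smoothedStep η r| ≤ 4 / K := by
      have : 4 / K = 2 / K + 2 / K := by ring
      rw [abs_le] at e1 e2 ⊢
      constructor <;> linarith [e1.1, e1.2, e2.1, e2.2]
    have e8 : 4 / K ≤ 20 * (1 / K * cauchyBump (r + L / 2) (L + ε)) := by
      have : 4 / K = 20 * (1 / K * (1 / 5)) := by ring
      rw [this]
      gcongr
      linarith
    linarith
  -- Far away, the derivative bound gives `η L / r²`. The endpoint bump absorbs it if `L ≤ W`, the
  -- midpoint bump otherwise.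
  · have e1 := abs_smoothedStep_sub_le hη hr0 le_rfl (by linarith : r ≤ r + L)
    rw [add_sub_cancel_left, show η / r ^ 2 = W / K / r ^ 2 by rw [← hηW]] at e1
    rcases le_or_gt L W with h2 | h2
    · have e2 : W / K / r ^ 2 * L ≤ 2 * cauchyBump r W := by
        have e3 : W / K ≤ W := div_le_self hW0.le hK
        calc W / K / r ^ 2 * L ≤ W / r ^ 2 * W := by gcongr
          _ = 2 * (W ^ 2 / (r ^ 2 + r ^ 2)) := by field_simp; ring
          _ ≤ _ := by unfold cauchyBump; gcongr
      have : 0 ≤ 1 / K * cauchyBump (r + L / 2) (L + ε) := by positivity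
      linarith
    · have hL1 : 0 < L := hW0.trans h2
      have e2 : W / K / r ^ 2 * L ≤ 20 * (1 / K * cauchyBump (r + L / 2) (L + ε)) := by
        calc W / K / r ^ 2 * L ≤ L / K / r ^ 2 * L := by gcongr
          _ = 1 / K * (L ^ 2 / r ^ 2) := by field_simp
          _ ≤ 1 / K * (20 * cauchyBump (r + L / 2) (L + ε)) := by
            gcongr
            unfold cauchyBump
            rw [mul_div_assoc', div_le_div_iff₀ (by positivity) (by positivity)]
            have q1 : (r + L / 2) ^ 2 ≤ 3 * r ^ 2 := by nlinarith
            have q2 : L ^ 2 ≤ (L + ε) ^ 2 := by gcongr; linarith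
            have q3 : L ^ 2 ≤ r ^ 2 := by gcongr
            have q4 : L ^ 2 * (r + L / 2) ^ 2 ≤ (L + ε) ^ 2 * (3 * r ^ 2) := by gcongr
            have q5 : L ^ 2 * (L + ε) ^ 2 ≤ r ^ 2 * (L + ε) ^ 2 := by gcongr
            have q6 : 0 ≤ r ^ 2 * (L + ε) ^ 2 := by positivity
            linarith
          _ = _ := by ring
      linarith

/-- Within `W = Kη` of an endpoint the error is merely bounded, which the endpoint bumps pay for;
elsewhere the tail of the kernel saves a factor `K`. The `ε` later keeps the width of the midpoint
bump above `log n / n`. -/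
theorem abs_indicator_sub_smoothedStep_le {J : Set ℝ} {a b η K W ε : ℝ} (hab : a ≤ b)
    (hJ1 : Set.Ioo a b ⊆ J) (hJ2 : J ⊆ Set.Icc a b) (hη : 0 < η) (hK : 1 ≤ K)
    (hW : W = K * η) (hε : 0 < ε) (s : ℝ) :
    |J.indicator (fun _ => (1 : ℝ)) s - (smoothedStep η (b - s) - smoothedStep η (a - s))| ≤
      20 * (cauchyBump (a - s) W + cauchyBump (b - s) W +
        1 / K * cauchyBump ((a + b) / 2 - s) (b - a + ε)) := by
  have hK0 : 0 < K := by linarith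
  have hW0 : 0 < W := by rw [hW]; positivity
  have hc1 := cauchyBump_nonneg (a - s) W
  have hc2 := cauchyBump_nonneg (b - s) W
  have hc3 : 0 ≤ 1 / K * cauchyBump ((a + b) / 2 - s) (b - a + ε) :=
    mul_nonneg (by positivity) (cauchyBump_nonneg _ _)
  by_cases hnear : |a - s| < W ∨ |b - s| < W
  · have h1 : |J.indicator (fun _ => (1 : ℝ)) s -
        (smoothedStep η (b - s) - smoothedStep η (a - s))| ≤ 5 := by
      have e1 := abs_le.1 (abs_smoothedStep_le hη (b - s))
      have e2 := abs_le.1 (abs_smoothedStep_le hη (a - s))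
      have e3 : 0 ≤ J.indicator (fun _ => (1 : ℝ)) s :=
        Set.indicator_nonneg (fun _ _ => zero_le_one) s
      have e4 : J.indicator (fun _ => (1 : ℝ)) s ≤ 1 :=
        Set.indicator_le_self' (fun _ _ => zero_le_one) s
      rw [abs_le]
      constructor <;> linarith [e1.1, e1.2, e2.1, e2.2]
    have hbump : ∀ r, |r| < W → 1 / 2 ≤ cauchyBump r W := by
      intro r hr
      have := le_cauchyBump (r := r) hW0 one_pos hW0 (by rw [← sq_abs, one_mul]; gcongr) le_rfl
      linarith
    rcases hnear with h | h
    · have := hbump _ h; linarith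
    · have := hbump _ h; linarith
  · push Not at hnear
    obtain ⟨ha, hb⟩ := hnear
    rcases lt_trichotomy s a with h | h | h
    · rw [abs_of_pos (by linarith)] at ha
      have hsJ : s ∉ J := fun hs => by linarith [(hJ2 hs).1]
      rw [Set.indicator_of_notMem hsJ, zero_sub, abs_neg]
      have := abs_smoothedStep_sub_le_of_left hab hη hK hW hε h ha
      linarith
    · rw [h, sub_self, abs_zero] at ha; linarith
    · rcases lt_trichotomy s b with h' | h' | h'
      · rw [abs_of_neg (by linarith)] at ha
        rw [abs_of_pos (by linarith)] at hb
        rw [Set.indicator_of_mem (hJ1 ⟨h, h'⟩), ← neg_sub s a, smoothedStep_neg]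
        have e1 := abs_half_sub_smoothedStep_le hη (by linarith : 0 < b - s)
        have e2 := abs_half_sub_smoothedStep_le hη (by linarith : 0 < s - a)
        have e3 : 2 * η / (b - s) ≤ 2 * η / W := by gcongr
        have e4 : 2 * η / (s - a) ≤ 2 * η / W := by gcongr; linarith
        have e5 : 2 * η / W = 2 / K := by rw [hW]; field_simp
        have e6 := le_cauchyBump (r := (a + b) / 2 - s) (R := b - a + ε) (c := 1) (S := b - a)
          (by linarith) one_pos (by linarith) (by nlinarith) (by linarith)
        have e8 : 4 / K ≤ 20 * (1 / K * cauchyBump ((a + b) / 2 - s) (b - a + ε)) := by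
          have : 4 / K = 20 * (1 / K * (1 / 5)) := by ring
          rw [this]
          gcongr
          linarith
        have e9 : |1 - (smoothedStep η (b - s) - -smoothedStep η (s - a))| ≤ 4 / K := by
          have : 4 / K = 2 / K + 2 / K := by ring
          rw [abs_le] at e1 e2 ⊢
          constructor <;> linarith [e1.1, e1.2, e2.1, e2.2]
        rw [← neg_sub s a] at hc1
        linarith
      · rw [h', sub_self, abs_zero] at hb; linarith
      · rw [abs_of_neg (by linarith)] at hb
        have hsJ : s ∉ J := fun hs => by linarith [(hJ2 hs).2]
        rw [Set.indicator_of_notMem hsJ, zero_sub, abs_neg]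
        -- Points to the right reduce to the left case by reflection, the step being odd.
        have := abs_smoothedStep_sub_le_of_left (a := -b) (b := -a) (s := -s) (by linarith) hη hK
          hW hε (by linarith) (by linarith)
        rw [show -a - -s = -(a - s) by ring, show -b - -s = -(b - s) by ring, smoothedStep_neg,
          smoothedStep_neg, show (-b + -a) / 2 - -s = -((a + b) / 2 - s) by ring,
          show -a - -b + ε = b - a + ε by ring,
          show -smoothedStep η (a - s) - -smoothedStep η (b - s) =
            smoothedStep η (b - s) - smoothedStep η (a - s) by ring] at this
        simp only [cauchyBump, neg_sq] at this hc1 ⊢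
        linarith

/-! ### Comparing the empirical measure with the density. -/

theorem continuous_nodePotential {n : ℕ} (x : Fin n → ℝ) {R : ℝ} (hR : 0 < R) :
    Continuous fun t => nodePotential x t R := by
  simp only [nodePotential]
  exact (continuous_const.mul (continuous_finsetSum _ fun i _ =>
    continuous_const.mul (Continuous.log (by fun_prop) fun t => by positivity))).neg

theorem integral_nodePotential_sub_eq {n : ℕ} (x : Fin n → ℝ) {η : ℝ} (hη : 0 < η) (a b : ℝ) :
    ∫ t in a..b, (nodePotential x t η - nodePotential x t (2 * η)) / (Real.pi * η) =
      (n : ℝ)⁻¹ * ∑ i, (smoothedStep η (b - x i) - smoothedStep η (a - x i)) := by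
  rw [Finset.sum_sub_distrib, mul_sub]
  refine intervalIntegral.integral_eq_sub_of_hasDerivAt
    (f := fun t => (n : ℝ)⁻¹ * ∑ i, smoothedStep η (t - x i)) (fun t _ => ?_) ?_
  · have h : ∀ i ∈ Finset.univ, HasDerivAt (fun t => smoothedStep η (t - x i)) _ t := fun i _ =>
      (hasDerivAt_smoothedStep hη (t - x i)).comp_sub_const t (x i)
    refine ((HasDerivAt.fun_sum h).const_mul (n : ℝ)⁻¹).congr_deriv ?_
    rw [nodePotential_sub_eq, ← Finset.mul_sum, ← Finset.mul_sum]
    have := Real.pi_pos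
    field_simp
  · exact (((continuous_nodePotential x hη).sub (continuous_nodePotential x
      (by positivity))).div_const _).intervalIntegrable a b

theorem nodePotential_neg {n : ℕ} (x : Fin n → ℝ) (t η : ℝ) :
    nodePotential x t (-η) = nodePotential x t η := by
  simp only [nodePotential, neg_sq]

theorem empiricalMeasure_real_le_one {n : ℕ} (x : Fin n → ℝ) {s : Set ℝ} (hs : MeasurableSet s) :
    (empiricalMeasure x).real s ≤ 1 := by
  rw [empiricalMeasure_real x hs]
  exact inv_natCast_mul_sum_const_le zero_le_one fun i =>
    Set.indicator_le_self' (fun _ _ => zero_le_one) (x i)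

theorem empiricalMeasure_Icc_le {n : ℕ} {x : Fin n → ℝ} {α κ D r y η : ℝ} (hκ : 0 < κ)
    (hD : 1 ≤ D) (hr : r ≤ D)
    (h : ∀ η, κ ≤ η → |nodePotential x y η - (α - Real.pi * η * r)| ≤ D * (κ + η ^ 3))
    (hη : 0 < η) :
    (empiricalMeasure x).real (Set.Icc (y - η) (y + η)) ≤ 80 * D * (η + κ) := by
  have h1 := inv_mul_sum_cauchyBump_le hκ hD hr h (by linarith : κ ≤ η + κ)
  rw [empiricalMeasure_real x measurableSet_Icc]
  calc (n : ℝ)⁻¹ * ∑ i, (Set.Icc (y - η) (y + η)).indicator (fun _ => (1 : ℝ)) (x i)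
      ≤ (n : ℝ)⁻¹ * ∑ i, 2 * cauchyBump (y - x i) (η + κ) := by
        gcongr with i
        by_cases hi : x i ∈ Set.Icc (y - η) (y + η)
        · rw [Set.indicator_of_mem hi]
          have h2 : |y - x i| ≤ η + κ := by
            rw [abs_le]; constructor <;> linarith [hi.1, hi.2]
          have := le_cauchyBump (r := y - x i) (R := η + κ) (c := 1) (S := η + κ) (by linarith)
            one_pos (by linarith) (by rw [← sq_abs, one_mul]; gcongr) le_rfl
          linarith
        · rw [Set.indicator_of_notMem hi]
          have := cauchyBump_nonneg (y - x i) (η + κ)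
          positivity
    _ = 2 * ((n : ℝ)⁻¹ * ∑ i, cauchyBump (y - x i) (η + κ)) := by rw [← Finset.mul_sum]; ring
    _ ≤ _ := by linarith

theorem abs_integral_nodePotential_sub_density_le {n : ℕ} {x : Fin n → ℝ} {ρ : ℝ → ℝ}
    {α κ D a b K : ℝ} (hκ : 0 < κ) (hD : 1 ≤ D) (hab : a ≤ b)
    (hρc : ContinuousOn ρ (Set.Icc a b))
    (h : ∀ y ∈ Set.Icc a b, ∀ η, κ ≤ η →
      |nodePotential x y η - (α - Real.pi * η * ρ y)| ≤ D * (κ + η ^ 3))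
    (hK : 1 ≤ K) (hKκ : K ^ 2 * κ ≤ 1) :
    |(∫ t in a..b, (nodePotential x t (K * κ) - nodePotential x t (2 * (K * κ))) /
      (Real.pi * (K * κ))) - ∫ t in a..b, ρ t| ≤ 4 * D * ((b - a) / K) := by
  have hπ := Real.pi_gt_three
  have hK0 : 0 < K := by linarith
  set η := K * κ with hη
  have hη0 : 0 < η := by positivity
  have hκη : κ ≤ η := by nlinarith
  have hρi : IntervalIntegrable ρ volume a b :=
    ContinuousOn.intervalIntegrable (by rwa [Set.uIcc_of_le hab])
  have hgi : IntervalIntegrable (fun t => (nodePotential x t η - nodePotential x t (2 * η)) /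
      (Real.pi * η)) volume a b :=
    (((continuous_nodePotential x hη0).sub (continuous_nodePotential x (by positivity))).div_const
      _).intervalIntegrable a b
  rw [← intervalIntegral.integral_sub hgi hρi]
  have hb : ∀ t ∈ Set.uIoc a b, ‖(nodePotential x t η - nodePotential x t (2 * η)) /
      (Real.pi * η) - ρ t‖ ≤ 4 * D / K := by
    intro t ht
    rw [Set.uIoc_of_le hab] at ht
    have htI : t ∈ Set.Icc a b := ⟨ht.1.le, ht.2⟩
    have e1 := h t htI η hκη
    have e2 := h t htI (2 * η) (by linarith)
    have e3 : (nodePotential x t η - nodePotential x t (2 * η)) / (Real.pi * η) - ρ t =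
        ((nodePotential x t η - (α - Real.pi * η * ρ t)) -
          (nodePotential x t (2 * η) - (α - Real.pi * (2 * η) * ρ t))) / (Real.pi * η) := by
      field_simp; ring
    rw [e3, Real.norm_eq_abs, abs_div, abs_of_pos (by positivity : 0 < Real.pi * η),
      div_le_div_iff₀ (by positivity) hK0]
    -- This makes the cubic error, divided by `η`, at most a multiple of `1 / K`; the other error `κ
    -- / η` equals `1 / K` by the choice of `η`.
    have e4 : K * η ^ 2 ≤ 1 := by
      have : K * η ^ 2 * K = (K ^ 2 * κ) ^ 2 := by rw [hη]; ring
      have : (K ^ 2 * κ) ^ 2 ≤ 1 := pow_le_one₀ (by positivity) hKκ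
      have : 0 ≤ K * η ^ 2 := by positivity
      nlinarith
    have e5 : (κ + η ^ 3 + (κ + (2 * η) ^ 3)) * K ≤ 11 * η := by
      have : (κ + η ^ 3 + (κ + (2 * η) ^ 3)) * K = 2 * η + 9 * (K * η ^ 2) * η := by rw [hη]; ring
      rw [this]
      have : K * η ^ 2 * η ≤ 1 * η := by gcongr
      linarith
    calc |_| * K ≤ (D * (κ + η ^ 3) + D * (κ + (2 * η) ^ 3)) * K := by
          gcongr
          exact (abs_sub _ _).trans (add_le_add e1 e2)
      _ = D * ((κ + η ^ 3 + (κ + (2 * η) ^ 3)) * K) := by ring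
      _ ≤ D * (11 * η) := by gcongr
      _ ≤ D * (4 * Real.pi * η) := by gcongr; linarith
      _ = _ := by ring
  have := intervalIntegral.norm_integral_le_of_norm_le_const hb
  rw [Real.norm_eq_abs, abs_of_nonneg (sub_nonneg.2 hab)] at this
  refine this.trans (le_of_eq (by ring))

theorem setIntegral_eq_intervalIntegral {J : Set ℝ} {a b : ℝ} (hab : a ≤ b)
    (hJ1 : Set.Ioo a b ⊆ J) (hJ2 : J ⊆ Set.Icc a b) (f : ℝ → ℝ) :
    ∫ t in J, f t = ∫ t in a..b, f t := by
  rw [intervalIntegral.integral_of_le hab]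
  refine setIntegral_congr_set ?_
  have h1 : Set.Ioo a b =ᵐ[volume] Set.Icc a b := Ioo_ae_eq_Icc
  have h2 : J =ᵐ[volume] Set.Icc a b :=
    (LE.le.eventuallyLE hJ2).antisymm (h1.symm.le.trans hJ1.eventuallyLE)
  exact h2.trans Ioc_ae_eq_Icc.symm

theorem abs_empiricalMeasure_sub_integral_le {n : ℕ} {x : Fin n → ℝ} {ρ : ℝ → ℝ} {J : Set ℝ}
    {α κ D a b K : ℝ} (hκ : 0 < κ) (hD : 1 ≤ D) (hab : a ≤ b) (hba : b - a ≤ 2)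
    (hJ1 : Set.Ioo a b ⊆ J) (hJ2 : J ⊆ Set.Icc a b) (hJm : MeasurableSet J)
    (hρc : ContinuousOn ρ (Set.Icc a b)) (hρ0 : ∀ y ∈ Set.Icc a b, 0 ≤ ρ y)
    (hρD : ∀ y ∈ Set.Icc a b, ρ y ≤ D)
    (h : ∀ y ∈ Set.Icc a b, ∀ η, κ ≤ η →
      |nodePotential x y η - (α - Real.pi * η * ρ y)| ≤ D * (κ + η ^ 3))
    (hK : 1 ≤ K) :
    |(empiricalMeasure x).real J - ∫ t in J, ρ t| ≤ 2500 * D * ((b - a) / K + K ^ 2 * κ) := by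
  have hK0 : 0 < K := by linarith
  have hL0 : 0 ≤ b - a := by linarith
  have hLK : 0 ≤ (b - a) / K := by positivity
  rw [setIntegral_eq_intervalIntegral hab hJ1 hJ2]
  -- If `K² κ ≥ 1` the claimed error exceeds both quantities compared.
  rcases le_or_gt 1 (K ^ 2 * κ) with h1 | h1
  · have e1 := empiricalMeasure_real_le_one x hJm
    have e2 : 0 ≤ (empiricalMeasure x).real J := measureReal_nonneg
    have e3 : |∫ t in a..b, ρ t| ≤ D * |b - a| := by
      rw [← Real.norm_eq_abs]
      refine intervalIntegral.norm_integral_le_of_norm_le_const fun t ht => ?_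
      rw [Set.uIoc_of_le hab] at ht
      have htI : t ∈ Set.Icc a b := ⟨ht.1.le, ht.2⟩
      rw [Real.norm_eq_abs, abs_of_nonneg (hρ0 t htI)]
      exact hρD t htI
    rw [abs_of_nonneg hL0] at e3
    calc _ ≤ |(empiricalMeasure x).real J| + |∫ t in a..b, ρ t| := abs_sub _ _
      _ ≤ 1 + D * 2 := by
        rw [abs_of_nonneg e2]
        exact add_le_add e1 (e3.trans (by gcongr))
      _ ≤ 2500 * D * (0 + 1) := by linarith
      _ ≤ _ := by gcongr
  · have hη0 : 0 < K * κ := by positivity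
    have hI := abs_integral_nodePotential_sub_density_le hκ hD hab hρc h hK h1.le
    rw [integral_nodePotential_sub_eq x hη0] at hI
    have ha : a ∈ Set.Icc a b := ⟨le_rfl, hab⟩
    have hb : b ∈ Set.Icc a b := ⟨hab, le_rfl⟩
    have hm : (a + b) / 2 ∈ Set.Icc a b := by constructor <;> linarith
    have hWκ : κ ≤ K * (K * κ) := by nlinarith [mul_pos hK0 hκ]
    have b1 := inv_mul_sum_cauchyBump_le hκ hD (hρD a ha) (h a ha) hWκ
    have b2 := inv_mul_sum_cauchyBump_le hκ hD (hρD b hb) (h b hb) hWκ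
    have b3 := inv_mul_sum_cauchyBump_le hκ hD (hρD _ hm) (h _ hm)
      (by linarith : κ ≤ b - a + κ)
    have hS : |(empiricalMeasure x).real J - (n : ℝ)⁻¹ * ∑ i,
        (smoothedStep (K * κ) (b - x i) - smoothedStep (K * κ) (a - x i))| ≤
        20 * (40 * D * (K * (K * κ)) + 40 * D * (K * (K * κ)) +
          1 / K * (40 * D * (b - a + κ))) := by
      rw [empiricalMeasure_real x hJm, ← mul_sub, ← Finset.sum_sub_distrib, abs_mul,
        abs_of_nonneg (by positivity : 0 ≤ (n : ℝ)⁻¹)]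
      calc _ ≤ (n : ℝ)⁻¹ * ∑ i, 20 * (cauchyBump (a - x i) (K * (K * κ)) +
            cauchyBump (b - x i) (K * (K * κ)) +
            1 / K * cauchyBump ((a + b) / 2 - x i) (b - a + κ)) := by
            gcongr
            refine (Finset.abs_sum_le_sum_abs _ _).trans (Finset.sum_le_sum fun i _ => ?_)
            exact abs_indicator_sub_smoothedStep_le hab hJ1 hJ2 hη0 hK rfl hκ (x i)
        _ = 20 * ((n : ℝ)⁻¹ * (∑ i, cauchyBump (a - x i) (K * (K * κ))) +
            (n : ℝ)⁻¹ * (∑ i, cauchyBump (b - x i) (K * (K * κ))) +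
            1 / K * ((n : ℝ)⁻¹ * ∑ i, cauchyBump ((a + b) / 2 - x i) (b - a + κ))) := by
            rw [← Finset.mul_sum, Finset.sum_add_distrib, Finset.sum_add_distrib,
              ← Finset.mul_sum]
            ring
        _ ≤ _ := by gcongr
    have hκK : κ / K ≤ K ^ 2 * κ := by
      rw [div_le_iff₀ hK0]
      have : 1 ≤ K ^ 2 * K := by nlinarith
      nlinarith
    have hfin : 20 * (40 * D * (K * (K * κ)) + 40 * D * (K * (K * κ)) +
          1 / K * (40 * D * (b - a + κ))) + 4 * D * ((b - a) / K) =
        D * (1600 * (K ^ 2 * κ) + 800 * (κ / K) + 804 * ((b - a) / K)) := by ring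
    calc _ ≤ _ := abs_sub_le _ ((n : ℝ)⁻¹ * ∑ i,
        (smoothedStep (K * κ) (b - x i) - smoothedStep (K * κ) (a - x i))) _
      _ ≤ _ := add_le_add hS hI
      _ = _ := hfin
      _ ≤ D * (1600 * (K ^ 2 * κ) + 800 * (K ^ 2 * κ) + 804 * ((b - a) / K)) := by gcongr
      _ ≤ _ := by
        have : 0 ≤ D * (K ^ 2 * κ) := by positivity
        have : 0 ≤ D * ((b - a) / K) := by positivity
        linarith

/-! ### Uniform estimates for the truncated density. -/

/-- The density, bounded below by `c₀`. -/
noncomputable def nodeDensity {n : ℕ} (x : Fin n → ℝ) (α c₀ : ℝ) (I : Set ℝ) (y : ℝ) : ℝ :=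
  max (potentialDensity x α Iᶜ y) c₀

/-- The constant of the estimates for the density at distance `d` from the complement. -/
noncomputable def densityConstant (c₁ cα c₀ d : ℝ) : ℝ :=
  1 + (1 + 2 / d + 1 / d ^ 2) * ((9 / d ^ 2 + 2) * ((∫ v, weightedLog v) + cα * Real.pi)) + c₀ +
    1 / c₀ + (2 * (4 + 2 * ∫ v, spike v) + c₁) +
    4 * ((4 + 2 * ∫ v, spike v) * ((9 / d ^ 2 + 2) * Real.pi + 1 / d ^ 2))

/-- Truncation at `c₀` gives a lower bound for every `n ≥ 3`, not just for large `n`. By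
`le_potentialDensity` it moves the density by only `O(log n / n)`. -/
theorem density_estimates {n : ℕ} (hn : 3 ≤ n) {x : Fin n → ℝ}
    (hx1 : ∀ i, x i ∈ Set.Icc (-1 : ℝ) 1) {I : Set ℝ} (hIm : MeasurableSet I)
    (hI1 : I ⊆ Set.Icc (-1) 1) {α c₁ cα T c₀ d : ℝ} (hc₁ : 0 ≤ c₁) (hα : |α| ≤ cα)
    (hT : 1 < T) (hTα : -Real.log (T - 1) ≤ α - 1)
    (hc₀ : c₀ = 1 / (Real.pi ^ 2 * (T + 2) ^ 2))
    (hup : ∀ t, t ∉ Set.range x → nodePotential x t 0 ≤ α + nodeError x t)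
    (hlow : ∀ t ∈ I, t ∉ Set.range x → α - c₁ * (Real.log n / n) ≤ nodePotential x t 0)
    (hd : 0 < d) :
    1 ≤ densityConstant c₁ cα c₀ d ∧ 1 / densityConstant c₁ cα c₀ d ≤ c₀ ∧
    ∀ y ∈ I, (∀ t ∈ Iᶜ, d ≤ |y - t|) →
      nodeDensity x α c₀ I y ≤ densityConstant c₁ cα c₀ d ∧
      (∀ z ∈ I, (∀ t ∈ Iᶜ, d ≤ |z - t|) →
        |nodeDensity x α c₀ I y - nodeDensity x α c₀ I z| ≤
          densityConstant c₁ cα c₀ d * |y - z|) ∧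
      ∀ η, Real.log n / n ≤ η →
        |nodePotential x y η - (α - Real.pi * η * nodeDensity x α c₀ I y)| ≤
          densityConstant c₁ cα c₀ d * (Real.log n / n + η ^ 3) := by
  have hπ := Real.pi_gt_three
  have hκ := log_div_natCast_pos hn
  have hκ1 := log_div_natCast_le_one n
  set κ := Real.log n / n with hκdef
  have hc₀pos : 0 < c₀ := by rw [hc₀]; positivity
  have hcα : 0 ≤ cα := (abs_nonneg α).trans hα
  have hH : 0 ≤ ∫ v, spike v := integral_nonneg spike_nonneg
  have hG : 0 ≤ ∫ v, weightedLog v := integral_nonneg weightedLog_nonneg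
  set M := (9 / d ^ 2 + 2) * ((∫ v, weightedLog v) + cα * Real.pi) with hM
  set E := (4 + 2 * ∫ v, spike v) * ((9 / d ^ 2 + 2) * Real.pi + 1 / d ^ 2) with hE
  have hM0 : 0 ≤ M := by positivity
  have hE0 : 0 ≤ E := by positivity
  have hMα : (9 / d ^ 2 + 2) * ((∫ v, weightedLog v) + |α| * Real.pi) ≤ M := by
    rw [hM]; gcongr
  have hDdef : densityConstant c₁ cα c₀ d = 1 + (M + 2 * M / d + 1 / d ^ 2 * M) + c₀ +
      1 / c₀ + (2 * (4 + 2 * ∫ v, spike v) + c₁) + 4 * E := by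
    rw [densityConstant, ← hM, ← hE]; ring
  set D := densityConstant c₁ cα c₀ d with hD
  have p1 : 0 ≤ 2 * M / d := by positivity
  have p2 : 0 ≤ 1 / d ^ 2 * M := by positivity
  have p3 : 0 < 1 / c₀ := by positivity
  have hD1 : 1 ≤ D := by rw [hDdef]; linarith
  refine ⟨hD1, ?_, fun y hyI hdy => ⟨?_, fun z hzI hdz => ?_, fun η hη => ?_⟩⟩
  · rw [one_div_le (by linarith) hc₀pos]
    rw [hDdef]; linarith
  · have h1 := (le_abs_self _).trans (abs_potentialDensity_le hx1 hIm.compl α hd (hI1 hyI) hdy)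
    refine max_le ?_ ?_
    · rw [hDdef]; linarith
    · rw [hDdef]; linarith
  · refine (abs_max_sub_max_le_abs _ _ _).trans
      ((abs_potentialDensity_sub_le hx1 hIm.compl α hd (hI1 hyI) hdy (hI1 hzI) hdz).trans ?_)
    gcongr
    calc _ ≤ 2 * M / d := by gcongr
      _ ≤ D := by rw [hDdef]; linarith
  · have hη0 : 0 < η := hκ.trans_le hη
    have h1 := abs_nodePotential_sub_le hn hx1 hIm (by positivity) hη hup hlow hd (hI1 hyI) hdy
    have h2 := le_potentialDensity hn hx1 hIm.compl
      (fun t ht hI => absurd (hI1 hI).2 (not_le.2 ht)) hT hTα hup hd (hI1 hyI) hdy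
    rw [← hc₀, ← hE, ← hκdef] at h2
    rw [← hκdef] at h1
    have h3 : |nodeDensity x α c₀ I y - potentialDensity x α Iᶜ y| ≤ E * κ := by
      have hEκ : 0 ≤ E * κ := by positivity
      rw [nodeDensity, abs_of_nonneg (sub_nonneg.2 (le_max_left _ _)), sub_le_iff_le_add]
      exact max_le (by linarith) (by linarith)
    -- The truncation error enters multiplied by `η`, which may be large; then `η³` absorbs it.
    have h4 : η * κ ≤ κ + η ^ 3 := by
      rcases le_or_gt η 1 with h | h
      · have : 0 ≤ η ^ 3 := by positivity
        nlinarith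
      · have : η ≤ η ^ 3 := le_self_pow₀ h.le (by norm_num)
        nlinarith
    have h5 : nodePotential x y η - (α - Real.pi * η * nodeDensity x α c₀ I y) =
        (nodePotential x y η - (α - Real.pi * η * potentialDensity x α Iᶜ y)) +
        Real.pi * η * (nodeDensity x α c₀ I y - potentialDensity x α Iᶜ y) := by ring
    have h6 : |Real.pi * η * (nodeDensity x α c₀ I y - potentialDensity x α Iᶜ y)| ≤
        4 * E * (κ + η ^ 3) := by
      rw [abs_mul, abs_of_pos (by positivity)]
      calc _ ≤ 4 * η * (E * κ) := by gcongr; exact Real.pi_le_four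
        _ = 4 * E * (η * κ) := by ring
        _ ≤ _ := by gcongr
    have h7 : η ^ 3 / d ^ 2 * ((9 / d ^ 2 + 2) * ((∫ v, weightedLog v) + |α| * Real.pi)) ≤
        1 / d ^ 2 * M * η ^ 3 := by
      calc _ ≤ η ^ 3 / d ^ 2 * M := by gcongr
        _ = _ := by ring
    rw [h5]
    refine (abs_add_le _ _).trans ((add_le_add (h1.trans (add_le_add le_rfl h7)) h6).trans ?_)
    have q1 : 0 ≤ η ^ 3 := by positivity
    have q2 : (2 * (4 + 2 * ∫ v, spike v) + c₁) * κ ≤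
        (2 * (4 + 2 * ∫ v, spike v) + c₁) * (κ + η ^ 3) := by gcongr; linarith
    have q3 : 1 / d ^ 2 * M * η ^ 3 ≤ 1 / d ^ 2 * M * (κ + η ^ 3) := by gcongr; linarith
    have q4 : 0 ≤ (1 + M + 2 * M / d + c₀ + 1 / c₀) * (κ + η ^ 3) := by positivity
    rw [hDdef]
    linarith

/-- Around an interior point a small ball keeps a fixed distance from `Iᶜ`, so the density is
locally Lipschitz there. -/
theorem continuousOn_nodeDensity {n : ℕ} {x : Fin n → ℝ} {α c₀ : ℝ} {I : Set ℝ}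
    (D : ℝ → ℝ) (hD : ∀ d, 0 < d → ∀ y ∈ I, (∀ t ∈ Iᶜ, d ≤ |y - t|) → ∀ z ∈ I,
      (∀ t ∈ Iᶜ, d ≤ |z - t|) →
        |nodeDensity x α c₀ I y - nodeDensity x α c₀ I z| ≤ D d * |y - z|) :
    ContinuousOn (nodeDensity x α c₀ I) (interior I) := by
  intro y hy
  obtain ⟨ε, hε, hball⟩ := Metric.isOpen_iff.1 isOpen_interior y hy
  have hfar : ∀ z ∈ Metric.ball y (ε / 2), z ∈ I ∧ ∀ t ∈ Iᶜ, ε / 2 ≤ |z - t| := by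
    intro z hz
    refine ⟨interior_subset (hball (Metric.ball_subset_ball (by linarith) hz)), fun t ht => ?_⟩
    by_contra! hlt
    refine ht (interior_subset (hball ?_))
    rw [Metric.mem_ball, Real.dist_eq] at hz ⊢
    have := abs_sub_le t z y
    rw [abs_sub_comm t z] at this
    linarith
  have hlip : LipschitzOnWith (D (ε / 2)).toNNReal (nodeDensity x α c₀ I)
      (Metric.ball y (ε / 2)) := by
    refine LipschitzOnWith.of_dist_le_mul fun z hz w hw => ?_
    rw [Real.dist_eq, Real.dist_eq]
    obtain ⟨hz1, hz2⟩ := hfar z hz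
    obtain ⟨hw1, hw2⟩ := hfar w hw
    refine (hD _ (by positivity) z hz1 hz2 w hw1 hw2).trans ?_
    gcongr
    exact Real.le_coe_toNNReal _
  exact (hlip.continuousOn.continuousAt
    (Metric.ball_mem_nhds y (by positivity))).continuousWithinAt

/-! ### Interval geometry and conclusion. -/

theorem exists_dist_compl_of_compactlyInside {I I' : Set ℝ} (h : IsFiniteInterval I')
    (hI : CompactlyInside I' I) :
    ∃ d, 0 < d ∧ ∀ y ∈ closure I', ∀ t ∈ Iᶜ, d ≤ |y - t| := by
  obtain ⟨d, hd, hsub⟩ := (Metric.isCompact_of_isClosed_isBounded isClosed_closure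
    h.2.2.closure).exists_thickening_subset_open isOpen_interior hI
  refine ⟨d, hd, fun y hy t ht => ?_⟩
  by_contra! hlt
  refine ht (interior_subset (hsub (Metric.mem_thickening_iff.2 ⟨y, hy, ?_⟩)))
  rwa [Real.dist_eq, abs_sub_comm]

theorem IsFiniteInterval.exists_endpoints {J : Set ℝ} (hJ : IsFiniteInterval J) :
    ∃ a b, a < b ∧ Set.Ioo a b ⊆ J ∧ J ⊆ Set.Icc a b ∧ Set.Icc a b ⊆ closure J ∧
      volume.real J = b - a := by
  obtain ⟨hoc, ⟨p, hp, q, hq, hpq⟩, hb⟩ := hJ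
  have hne : J.Nonempty := ⟨p, hp⟩
  have hsub : J ⊆ Set.Icc (sInf J) (sSup J) := fun t ht =>
    ⟨csInf_le hb.bddBelow ht, le_csSup hb.bddAbove ht⟩
  have hlt : sInf J < sSup J := by
    rcases lt_or_gt_of_ne hpq with h | h
    · exact (hsub hp).1.trans_lt (h.trans_le (hsub hq).2)
    · exact (hsub hq).1.trans_lt (h.trans_le (hsub hp).2)
  have hIoo : Set.Ioo (sInf J) (sSup J) ⊆ J := by
    intro t ht
    obtain ⟨u, hu, hut⟩ := exists_lt_of_csInf_lt hne ht.1
    obtain ⟨v, hv, htv⟩ := exists_lt_of_lt_csSup hne ht.2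
    exact hoc.out hu hv ⟨hut.le, htv.le⟩
  refine ⟨_, _, hlt, hIoo, hsub, ?_, ?_⟩
  · rw [← closure_Ioo hlt.ne]
    exact closure_mono hIoo
  · have h1 : volume J = volume (Set.Icc (sInf J) (sSup J)) := by
      refine le_antisymm (measure_mono hsub) ?_
      rw [Real.volume_Icc, ← Real.volume_Ioo]
      exact measure_mono hIoo
    rw [measureReal_def, h1, ← measureReal_def, Real.volume_real_Icc_of_le hlt.le]

/-- The distance from `I'` to the complement of `I`, when positive. -/
noncomputable def complementGap (I I' : Set ℝ) : ℝ :=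
  open Classical in
  if h : ∃ d, 0 < d ∧ ∀ y ∈ closure I', ∀ t ∈ Iᶜ, d ≤ |y - t| then h.choose else 1

theorem complementGap_pos (I I' : Set ℝ) : 0 < complementGap I I' := by
  unfold complementGap
  split_ifs with h
  · exact h.choose_spec.1
  · exact one_pos

theorem complementGap_le {I I' : Set ℝ} (h : IsFiniteInterval I') (hI : CompactlyInside I' I) :
    ∀ y ∈ closure I', ∀ t ∈ Iᶜ, complementGap I I' ≤ |y - t| := by
  have h' := exists_dist_compl_of_compactlyInside h hI
  rw [complementGap, dif_pos h']
  exact h'.choose_spec.2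

theorem log_mul_rpow_div_le {n : ℕ} (hn : 3 ≤ n) {b p : ℝ} (hb : 1 ≤ b) :
    Real.log (b * (n : ℝ) ^ p) / n ≤ (Real.log b + p) * (Real.log n / n) := by
  have hn' : (0 : ℝ) < n := by exact_mod_cast (by lia : 0 < n)
  have hlog := one_le_log_natCast hn
  have hb0 := Real.log_nonneg hb
  rw [Real.log_mul (by linarith) (Real.rpow_pos_of_pos hn' p).ne', Real.log_rpow hn',
    mul_div_assoc']
  gcongr
  nlinarith

theorem mainTheorem6 (I : Set ℝ) (hI : IsFiniteInterval I) (hI1 : I ⊆ Set.Icc (-1) 1)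
    (B A : ℝ) :
    ∃ (N : ℕ) (C : ℝ) (D : Set ℝ → ℝ), 0 < C ∧ (∀ I' : Set ℝ, 0 < D I') ∧
      ∀ n : ℕ, N ≤ n → ∀ x : Fin n → ℝ, Function.Injective x →
        (∀ i, x i ∈ Set.Icc (-1 : ℝ) 1) →
        (∀ t ∈ I, lebesgueFunction x t ≤ B * (n : ℝ) ^ A) →
        ∃ (α : ℝ) (ρ : ℝ → ℝ),
          -- (i) near-constant log-potential on `I`
          |α| ≤ C ∧
          (∀ t ∈ I,
            nodeDistance x t * Real.exp (-(n * α)) ≤ |(nodePolynomial x).eval t| ∧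
            |(nodePolynomial x).eval t| ≤ C * (n : ℝ) ^ C * Real.exp (-(n * α))) ∧
          (∀ t ∈ I, t ∉ Set.range x →
            α - C * (Real.log n / n) ≤ logPotential (empiricalMeasure x) (t : ℂ) ∧
            logPotential (empiricalMeasure x) (t : ℂ) ≤
              α + Real.log (1 / nodeDistance x t) / n) ∧
          ContinuousOn ρ (interior I) ∧
          ∀ I' : Set ℝ, IsFiniteInterval I' → CompactlyInside I' I →
            -- (ii) bounds and Lipschitz continuity of the density
            (∀ t₀ ∈ I', 1 / D I' ≤ ρ t₀ ∧ ρ t₀ ≤ D I') ∧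
            (∀ t ∈ I', ∀ t₀ ∈ I', |ρ t - ρ t₀| ≤ D I' * |t - t₀|) ∧
            (∀ t ∈ I', ∀ η : ℝ, Real.log n / n ≤ η →
              |logPotential (empiricalMeasure x) ((t : ℂ) + Complex.I * (η : ℂ))
                  - (α - Real.pi * η * ρ t)| ≤ D I' * (Real.log n / n + η ^ 3) ∧
              |logPotential (empiricalMeasure x) ((t : ℂ) - Complex.I * (η : ℂ))
                  - (α - Real.pi * η * ρ t)| ≤ D I' * (Real.log n / n + η ^ 3)) ∧
            -- (iii) density of states upper bound
            (∀ t ∈ I', ∀ η : ℝ, 0 < η →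
              (empiricalMeasure x).real (Set.Icc (t - η) (t + η)) ≤
                D I' * (η + Real.log n / n)) ∧
            -- (iv) density of states asymptotic
            (∀ J : Set ℝ, IsFiniteInterval J → J ⊆ I' → ∀ K : ℝ, 1 ≤ K →
              |(empiricalMeasure x).real J - ∫ t in J, ρ t| ≤
                D I' * (volume.real J / K + K ^ 2 * Real.log n / n)) := by
  obtain ⟨p, q, hpq, -, -, -, hvol⟩ := hI.exists_endpoints
  have hIm : MeasurableSet I := hI.1.measurableSet
  have hIpos : 0 < volume.real I := by linarith
  have hG : 0 ≤ ∫ v, weightedLog v := integral_nonneg weightedLog_nonneg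
  obtain ⟨b, hb⟩ : ∃ b, b = 2 * |B| + 1 := ⟨_, rfl⟩
  obtain ⟨c₁, hc₁⟩ : ∃ c₁, c₁ = Real.log b + (|A| + 1) := ⟨_, rfl⟩
  -- The terms come from `α ≥ -log 3` and from the mean of the potential over `I`; `c₁` suffices for
  -- the loss `c₁ log n / n`, as `log n / n ≤ 1`.
  obtain ⟨cα, hcα⟩ : ∃ cα, cα = Real.log 3 + 5 * (∫ v, weightedLog v) / volume.real I + c₁ :=
    ⟨_, rfl⟩
  -- Chosen so that `-log (T - 1) = -cα - 1 ≤ α - 1`.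
  obtain ⟨T, hT⟩ : ∃ T, T = 1 + Real.exp (cα + 1) := ⟨_, rfl⟩
  obtain ⟨c₀, hc₀⟩ : ∃ c₀, c₀ = 1 / (Real.pi ^ 2 * (T + 2) ^ 2) := ⟨_, rfl⟩
  have hb1 : 1 ≤ b := by linarith [abs_nonneg B]
  have hlogb := Real.log_nonneg hb1
  have hc₁0 : 0 ≤ c₁ := by rw [hc₁]; positivity
  have hlog3 : 0 ≤ Real.log 3 := Real.log_nonneg (by norm_num)
  have hq0 : 0 ≤ 5 * (∫ v, weightedLog v) / volume.real I := by positivity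
  have hT1 : 1 < T := by rw [hT]; linarith [Real.exp_pos (cα + 1)]
  have hA := abs_nonneg A
  have hc₀pos : 0 < c₀ := by rw [hc₀]; have := Real.pi_pos; positivity
  have hcα0 : 0 ≤ cα := by linarith
  -- The threshold `3` is what makes `log n ≥ 1`. The gap of `I'` depends only on `I` and `I'`, so
  -- the constants are fixed before `n` and the nodes.
  refine ⟨3, b + (|A| + 1) + cα + c₁,
    fun I' => 2500 * densityConstant c₁ cα c₀ (complementGap I I'), by linarith, fun I' => ?_, ?_⟩
  · have hH : 0 ≤ ∫ v, spike v := integral_nonneg spike_nonneg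
    have := complementGap_pos I I'
    have := Real.pi_pos
    unfold densityConstant
    positivity
  intro n hn x hx hx1 hlam
  have hn0 : 0 < n := by lia
  have hn' : (1 : ℝ) ≤ n := by exact_mod_cast hn0
  have hκ := log_div_natCast_pos hn
  have hκ1 := log_div_natCast_le_one n
  obtain ⟨α, hα1, hα2⟩ := exists_equilibrium_constant hn0 hx hx1 hI1
    (Λ := |B| * (n : ℝ) ^ A) (by positivity)
    fun t ht => (hlam t ht).trans (by gcongr; exact le_abs_self B)
  have hα3 : ∀ t ∈ I, |(nodePolynomial x).eval t| ≤
      b * (n : ℝ) ^ (|A| + 1) * Real.exp (-(n * α)) := by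
    intro t ht
    refine (hα2 t ht).trans (mul_le_mul_of_nonneg_right ?_ (Real.exp_pos _).le)
    calc 2 * (|B| * (n : ℝ) ^ A) * n = 2 * |B| * ((n : ℝ) ^ A * n) := by ring
      _ ≤ b * ((n : ℝ) ^ |A| * n) := by
        gcongr
        · linarith
        · exact le_abs_self A
      _ = _ := by rw [Real.rpow_add_one (by positivity)]
  have hup' : ∀ t, t ∉ Set.range x →
      nodePotential x t 0 ≤ α + Real.log (1 / nodeDistance x t) / n :=
    fun t ht => nodePotential_le_of_le hn0 ht (hα1 t)
  have hup : ∀ t, t ∉ Set.range x → nodePotential x t 0 ≤ α + nodeError x t := fun t ht =>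
    (hup' t ht).trans (by gcongr; exact log_nodeDistance_le_nodeError hn0 ht)
  have hlow : ∀ t ∈ I, t ∉ Set.range x → α - c₁ * (Real.log n / n) ≤ nodePotential x t 0 := by
    intro t htI ht
    have h1 := le_nodePotential_of_le hn0 (by positivity) ht (hα3 t htI)
    have h2 := log_mul_rpow_div_le hn (p := |A| + 1) hb1
    rw [← hc₁] at h2
    linarith
  have hα : |α| ≤ cα := by
    have h1 := neg_log_three_le_of_bound hn0 hx1 hup'
    have h2 := equilibrium_constant_le hx1 hIm hI1 hIpos hlow
    rw [abs_le]
    constructor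
    · linarith
    · nlinarith
  have hTα : -Real.log (T - 1) ≤ α - 1 := by
    rw [hT, add_sub_cancel_left, Real.log_exp]
    linarith [(abs_le.1 hα).1]
  have hest := fun d hd => density_estimates hn hx1 hIm hI1 (d := d) hc₁0 hα hT1 hTα hc₀ hup hlow hd
  refine ⟨α, nodeDensity x α c₀ I, by linarith, fun t ht => ⟨hα1 t, ?_⟩, fun t htI ht => ?_, ?_, ?_⟩
  · refine (hα3 t ht).trans ?_
    gcongr <;> linarith
  · rw [logPotential_empiricalMeasure, Complex.ofReal_re, Complex.ofReal_im]
    refine ⟨le_trans ?_ (hlow t htI ht), hup' t ht⟩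
    gcongr
    linarith
  · exact continuousOn_nodeDensity _ fun d hd y hyI hdy z hzI hdz =>
      ((hest d hd).2.2 y hyI hdy).2.1 z hzI hdz
  · intro I' hI' hI'I
    have hgap := complementGap_le hI' hI'I
    have hclI : closure I' ⊆ I := hI'I.trans interior_subset
    obtain ⟨hD1, hDc, hD⟩ := hest _ (complementGap_pos I I')
    set D := densityConstant c₁ cα c₀ (complementGap I I') with hDdef
    have hD0 : D ≤ 2500 * D := by linarith
    have hy : ∀ y ∈ closure I', nodeDensity x α c₀ I y ≤ D ∧
        (∀ z ∈ closure I', |nodeDensity x α c₀ I y - nodeDensity x α c₀ I z| ≤ D * |y - z|) ∧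
        ∀ η, Real.log n / n ≤ η →
          |nodePotential x y η - (α - Real.pi * η * nodeDensity x α c₀ I y)| ≤
            D * (Real.log n / n + η ^ 3) := fun y hy => by
      obtain ⟨h1, h2, h3⟩ := hD y (hclI hy) (hgap y hy)
      exact ⟨h1, fun z hz => h2 z (hclI hz) (hgap z hz), h3⟩
    have hρ0 : ∀ y, c₀ ≤ nodeDensity x α c₀ I y := fun y => le_max_right _ _
    refine ⟨fun t ht => ⟨?_, ?_⟩, fun t ht t₀ ht₀ => ?_, fun t ht η hη => ?_, fun t ht η hη => ?_,
      fun J hJ hJI K hK => ?_⟩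
    · refine le_trans ?_ (hDc.trans (hρ0 t))
      gcongr
    · exact (hy t (subset_closure ht)).1.trans hD0
    · refine ((hy t (subset_closure ht)).2.1 t₀ (subset_closure ht₀)).trans ?_
      gcongr
    · have hη0 : 0 < η := hκ.trans_le hη
      have h := (hy t (subset_closure ht)).2.2 η hη
      have h2 : D * (Real.log n / n + η ^ 3) ≤ 2500 * D * (Real.log n / n + η ^ 3) := by gcongr
      rw [logPotential_empiricalMeasure, logPotential_empiricalMeasure]
      simp only [Complex.add_re, Complex.add_im, Complex.sub_re, Complex.sub_im, Complex.mul_re,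
        Complex.mul_im, Complex.ofReal_re, Complex.ofReal_im, Complex.I_re, Complex.I_im, mul_zero,
        zero_mul, one_mul, sub_zero, add_zero, zero_add, zero_sub, nodePotential_neg]
      exact ⟨h.trans h2, h.trans h2⟩
    · obtain ⟨h1, -, h3⟩ := hy t (subset_closure ht)
      refine (empiricalMeasure_Icc_le hκ hD1 h1 h3 hη).trans ?_
      gcongr ?_ * _
      change 80 * D ≤ 2500 * D
      linarith
    · obtain ⟨a, c, hac, hJ1, hJ2, hJ3, hJv⟩ := hJ.exists_endpoints
      have hsub : Set.Icc a c ⊆ closure I' := hJ3.trans (closure_mono hJI)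
      have ha := hI1 (hclI (hsub ⟨le_rfl, hac.le⟩))
      have hc := hI1 (hclI (hsub ⟨hac.le, le_rfl⟩))
      rw [hJv, mul_div_assoc]
      refine abs_empiricalMeasure_sub_integral_le hκ hD1 hac.le (by linarith [ha.1, hc.2]) hJ1 hJ2
        hJ.1.measurableSet ?_ (fun y _ => hc₀pos.le.trans (hρ0 y)) (fun y hyJ => (hy y (hsub hyJ)).1)
        (fun y hyJ => (hy y (hsub hyJ)).2.2) hK
      exact (continuousOn_nodeDensity _ fun d hd y hyI hdy z hzI hdz =>
        ((hest d hd).2.2 y hyI hdy).2.1 z hzI hdz).mono (hsub.trans hI'I)
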